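/- A hypergraph consists of a finite vertex set and a set of edges, each a subset of the vertex set; it is a $k$-graph if every edge has exactly $k$ vertices, and it is linear if any two distinct edges share at most one vertex. A hypergraph with at least one vertex is $r$-regular if each of its vertices lies in exactly $r$ edges. A subhypergraph of $G$ is a hypergraph whose vertex set and edge set are contained in those of $G$. Let $f_r^{(k)}(n)$ denote the maximum number of edges in an $n$-vertex linear $k$-graph which contains no $r$-regular subhypergraph. Theorem 1.3. For every integer $k \ge 2$ there are positive constants $C_0=C_0(k)$, $C_1=C_1(k)$ and $C_2=C_2(k)$ such that for all integers $2\le r\le n$ we have $$f_r^{(k)}(n)\le C_1\, r^{\frac{1}{k-1}}\, n^{2-\frac{1}{k-1}}(\log n)^{C_2},$$ and, if moreover $n\ge k$, $$C_0\, r^{\frac{1}{k-1}}\, n^{2-\frac{r}{(r-1)(k-1)}}\le f_r^{(k)}(n).$$ -/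

import Mathlib

namespace Hypergraph

/-- A `k`-graph: every edge has exactly `k` vertices. -/
def IsUniform {α : Type*} (H : Hypergraph α) (k : ℕ) : Prop :=
  ∀ e ∈ H.edgeSet, e.encard = k

/-- Any two distinct edges intersect in at most one vertex. -/
def IsLinear {α : Type*} (H : Hypergraph α) : Prop :=
  ∀ e ∈ H.edgeSet, ∀ f ∈ H.edgeSet, e ≠ f → (e ∩ f).encard ≤ 1

/-- The degree of `x`: the number of edges containing `x`. -/
noncomputable def degree {α : Type*} (H : Hypergraph α) (x : α) : ℕ∞ :=
  {e | e ∈ H.edgeSet ∧ x ∈ e}.encard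

/-- `H` has a vertex, and each of its vertices has degree `r`. -/
def IsRegular {α : Type*} (H : Hypergraph α) (r : ℕ) : Prop :=
  H.vertexSet.Nonempty ∧ ∀ x ∈ H.vertexSet, H.degree x = r

/-- `K` is a (not necessarily induced, not necessarily spanning) subhypergraph of `H`. -/
def IsSubhypergraph {α : Type*} (K H : Hypergraph α) : Prop :=
  K.vertexSet ⊆ H.vertexSet ∧ K.edgeSet ⊆ H.edgeSet

/-- The numbers of edges of the linear `k`-graphs on the vertex set `Fin n` that have no
`r`-regular subhypergraph. -/
def regularFreeEdgeCounts (k r n : ℕ) : Set ℕ :=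
  {m | ∃ H : Hypergraph (Fin n), H.vertexSet = Set.univ ∧ H.IsUniform k ∧ H.IsLinear ∧
    (¬ ∃ K : Hypergraph (Fin n), K.IsSubhypergraph H ∧ K.IsRegular r) ∧
    H.edgeSet.ncard = m}

/-- The maximum number of edges of an `n`-vertex linear `k`-graph with no `r`-regular
subhypergraph. -/
noncomputable def maxRegularFree (k r n : ℕ) : ℕ :=
  sSup (regularFreeEdgeCounts k r n)

/-- For `r ≥ 1` the supremum defining `maxRegularFree` is an attained maximum. -/
theorem isGreatest_maxRegularFree (k r n : ℕ) (hr : 1 ≤ r) :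
    IsGreatest (regularFreeEdgeCounts k r n) (maxRegularFree k r n) := by
  have hb : BddAbove (regularFreeEdgeCounts k r n) := by
    refine ⟨(Set.univ : Set (Set (Fin n))).ncard, ?_⟩
    rintro m ⟨H, -, -, -, -, rfl⟩
    exact Set.ncard_le_ncard (Set.subset_univ _) Set.finite_univ
  have hne : (regularFreeEdgeCounts k r n).Nonempty := by
    refine ⟨0, trivialOn Set.univ, rfl, ?_, ?_, ?_, by simp⟩
    · intro e he
      simp at he
    · intro e he
      simp at he
    · rintro ⟨K, ⟨-, hE⟩, ⟨x, hx⟩, hd⟩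
      have h0 : K.edgeSet = ∅ := by simpa using hE
      have h1 := hd x hx
      simp only [degree, h0, Set.mem_empty_iff_false, false_and, Set.ofPred_false,
        Set.encard_empty] at h1
      have h2 : r = 0 := by exact_mod_cast h1.symm
      omega
  exact ⟨Nat.sSup_mem hne hb, fun m hm => le_csSup hb hm⟩

end Hypergraph

/-! Upper bound. Take many matchings with `w` edges that all occupy the same vertex set. A sunflower
with `r` petals among them yields, after removal of the kernel, `r` edge-disjoint perfect matchings
of one common vertex set, and their union is `r`-regular. So if there is no `r`-regular
subhypergraph, the number of `w`-matchings is at most the number of possible vertex sets times the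
sunflower bound `(16 r J²) ^ w` with `J` logarithmic in `w` (`exists_sunflower`,
`card_matchingsOfCard_le`). Greedy choice gives at least `b ^ w / w!` matchings as long as `w` edges
block all but `b` edges. Taking `w`-th roots bounds the number of edges (`card_class_bound`). High
degrees would force `w` to be small. This is compensated by passing to a dyadic class of edges with
degrees at most `2D`, each edge meeting the set `A` of vertices of degree at least `D`: since `A`
has at most `k|E|/D` elements, fewer vertex sets are possible (`card_edges_pow_le`). The sunflower
lemma rests on spread families: a random union of colour classes contains a member of such a family
with probability at least one half (`spread_colouring`), proved by exposing one colour at a time and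
halving what remains to be covered.

Lower bound. Take a random `k`-partite `k`-graph with one part of size `a` and the others of size
`m`, and delete an edge from every pair that violates linearity and from every regular subfamily
(`le_maxRegularFree_of_sparse`). A regular subfamily uses equally many vertices in every part, hence
at most `a`. Shrinking one part thus removes the large regular configurations, and `a` is taken as
large as the first moment allows. -/

section

open Finset

/-! ### Spread families, random colourings and sunflowers. -/

/-- The part of the ground set whose colour lies in `Q`. -/
def colourClass {X C : Type*} [Fintype X] [DecidableEq C] (c : X → C) (Q : Finset C) : Finset X :=
  {x | c x ∈ Q}

/-- A minimum fragment exists: among the members of `G` contained in `T i ∪ W`, one whose part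
outside `W` is smallest. -/
theorem exists_min_fragment {X ι : Type*} [DecidableEq X] (T : ι → Finset X) (G : Finset ι)
    (W : Finset X) (i : ι) (hi : i ∈ G) :
    ∃ j ∈ G, T j ⊆ T i ∪ W ∧ ∀ j' ∈ G, T j' ⊆ T i ∪ W → #(T j \ W) ≤ #(T j' \ W) := by
  obtain ⟨j, hj, hmin⟩ := exists_min_image (G.filter fun j => T j ⊆ T i ∪ W)
    (fun j => #(T j \ W)) ⟨i, by simp [hi]⟩
  simp only [mem_filter] at hj hmin
  exact ⟨j, hj.1, hj.2, fun j' h h' => hmin j' ⟨h, h'⟩⟩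

open Classical in
/-- The index of a minimum fragment of `T i` with respect to `W`. -/
noncomputable def fragmentIndex {X ι : Type*} [DecidableEq X] (T : ι → Finset X) (G : Finset ι)
    (W : Finset X) (i : ι) : ι :=
  if hi : i ∈ G then (exists_min_fragment T G W i hi).choose else i

theorem fragmentIndex_spec {X ι : Type*} [DecidableEq X] (T : ι → Finset X) (G : Finset ι)
    (W : Finset X) (i : ι) (hi : i ∈ G) :
    fragmentIndex T G W i ∈ G ∧ T (fragmentIndex T G W i) ⊆ T i ∪ W ∧
      ∀ j' ∈ G, T j' ⊆ T i ∪ W → #(T (fragmentIndex T G W i) \ W) ≤ #(T j' \ W) := by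
  rw [fragmentIndex, dif_pos hi]
  exact (exists_min_fragment T G W i hi).choose_spec

/-- The state reached after exposing the colours in `Q`: the indices in `G c` are those that are
still under control, and `T c i` is what remains to be covered of some member of the family. -/
structure FragmentStage {X ι C : Type*} [Fintype X] [Fintype ι] [Fintype C] [DecidableEq X]
    [DecidableEq ι] [DecidableEq C] (S : ι → Finset X) (Q : Finset C) (w M j : ℕ)
    (T : (X → C) → ι → Finset X) (G : (X → C) → Finset ι) : Prop where
  subset : ∀ c, ∀ i ∈ G c, T c i ⊆ S i
  covers : ∀ c, ∀ i ∈ G c, ∃ i', S i' ⊆ T c i ∪ colourClass c Q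
  avoids : ∀ c, ∀ i ∈ G c, ∀ x ∈ T c i, c x ∉ Q
  card_le : ∀ c, ∀ i ∈ G c, #(T c i) ≤ w
  -- The state depends only on the colours already exposed, so points of other colours may be
  -- recoloured freely within the unexposed colours.
  congr : ∀ c c', (∀ x, ∀ q ∈ Q, c x = q ↔ c' x = q) → T c = T c' ∧ G c = G c'
  lost : #{p : ι × (X → C) | p.1 ∉ G p.2} * M ≤
    4 * j * (Fintype.card ι * Fintype.card C ^ Fintype.card X)

/-- Pairs `(i, c)` for which the fragment is a given set `t` and recolouring it gives `c'`. -/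
theorem card_pairs_le {X ι C : Type*} [Fintype X] [Fintype ι] [Fintype C] [DecidableEq X]
    (S : ι → Finset X) (M : ℕ)
    (hspread : ∀ Z : Finset X, #{i | Z ⊆ S i} * (Fintype.card C * M) ^ #Z ≤ Fintype.card ι)
    (t : Finset X) (c' : X → C) :
    #(({i | t ⊆ S i} : Finset ι) ×ˢ
      Fintype.piFinset (fun x => if x ∈ t then (univ : Finset C) else {c' x})) * M ^ #t ≤
        Fintype.card ι := by
  have h1 : #(Fintype.piFinset (fun x => if x ∈ t then (univ : Finset C) else {c' x})) =
      Fintype.card C ^ #t := by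
    rw [Fintype.card_piFinset]
    have : ∀ x, #(if x ∈ t then (univ : Finset C) else {c' x}) =
        if x ∈ t then Fintype.card C else 1 := by
      intro x; split_ifs <;> simp [Finset.card_univ]
    simp only [this]
    rw [Finset.prod_ite]
    simp
  rw [card_product, h1, mul_assoc, ← mul_pow]
  exact hspread t

section
variable {X ι C : Type*} [Fintype X] [Fintype ι] [Fintype C] [DecidableEq X]
    [DecidableEq ι] [DecidableEq C]

/-- Recolour the fragment with `q` and count the pairs that lead to one colouring `c'`. Minimality
confines all their fragments to a single set `V` of at most `w` points determined by `c'`. This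
leaves at most `2 ^ w` fragments, and spreadness makes each large one rare. -/
theorem card_large_fragments_le {S : ι → Finset X} {Q : Finset C} {w M j : ℕ}
    {T : (X → C) → ι → Finset X} {G : (X → C) → Finset ι}
    (hst : FragmentStage S Q w M j T G) (hM : 4 ≤ M)
    (hspread : ∀ Z : Finset X, #{i | Z ⊆ S i} * (Fintype.card C * M) ^ #Z ≤ Fintype.card ι)
    {q : C} (hq : q ∉ Q) :
    #{p : ι × (X → C) | p.1 ∈ G p.2 ∧ w / 2 < #(T p.2 (fragmentIndex (T p.2) (G p.2)
      (colourClass p.2 {q}) p.1) \ colourClass p.2 {q})} * M ≤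
      4 * (Fintype.card ι * Fintype.card C ^ Fintype.card X) := by
  classical
  set F : (X → C) → ι → Finset X := fun c i =>
    T c (fragmentIndex (T c) (G c) (colourClass c {q}) i) \ colourClass c {q} with hF
  set rec : ι × (X → C) → (X → C) := fun p x => if x ∈ F p.2 p.1 then q else p.2 x with hrec
  set N : Finset (ι × (X → C)) := {p | p.1 ∈ G p.2 ∧ w / 2 < #(F p.2 p.1)} with hN
  have hfib : ∀ c' : X → C, #{p ∈ N | rec p = c'} * M ≤ 4 * Fintype.card ι := by
    intro c'
    -- a canonical member of the family inside the recoloured class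
    obtain ⟨V, hVw, hV⟩ : ∃ V : Finset X, #V ≤ w ∧ ∀ p ∈ N, rec p = c' → F p.2 p.1 ⊆ V := by
      by_cases hex : ∃ i ∈ G c', T c' i ⊆ colourClass c' {q}
      · obtain ⟨i₀, hi₀, hsub⟩ := hex
        refine ⟨T c' i₀, hst.card_le _ _ hi₀, ?_⟩
        rintro ⟨i, c⟩ hp hpc
        simp only [hN, mem_filter, mem_univ, true_and] at hp
        obtain ⟨hs1, hs2, hs3⟩ := fragmentIndex_spec (T c) (G c) (colourClass c {q}) i hp.1
        have hFs : F c i ⊆ T c (fragmentIndex (T c) (G c) (colourClass c {q}) i) := sdiff_subset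
        have hFi : F c i ⊆ T c i := by
          intro x hx
          simp only [hF, mem_sdiff] at hx
          have := hs2 hx.1
          simp only [mem_union] at this
          tauto
        -- Recolouring moves only points of the fragment, whose old and new colours both lie outside
        -- `Q`.
        have hcc : ∀ x, ∀ q' ∈ Q, c x = q' ↔ c' x = q' := by
          intro x q' hq'
          rw [← hpc]
          simp only [hrec]
          split_ifs with hx
          · have := hst.avoids c _ hs1 x (hFs hx)
            constructor
            · rintro rfl; exact absurd hq' this
            · rintro rfl; exact absurd hq' hq
          · rfl
        obtain ⟨hT, hG⟩ := hst.congr c c' hcc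
        rw [← hT] at hsub ⊢
        rw [← hG] at hi₀
        have hsub' : T c i₀ ⊆ F c i ∪ colourClass c {q} := by
          intro x hx
          have := hsub hx
          rw [← hpc] at this
          simp only [colourClass, hrec, mem_filter, mem_univ, true_and, mem_singleton] at this
          simp only [colourClass, mem_union, mem_filter, mem_univ, true_and, mem_singleton]
          split_ifs at this with h
          · exact Or.inl h
          · exact Or.inr this
        -- The canonical member `T c i₀` competes for the minimum and leaves a remainder inside the
        -- fragment, so the two coincide.
        have hle := hs3 i₀ hi₀ (hsub'.trans (union_subset_union hFi Subset.rfl))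
        have hsub2 : T c i₀ \ colourClass c {q} ⊆ F c i := by
          intro x hx
          simp only [mem_sdiff] at hx
          have := hsub' hx.1
          simp only [mem_union] at this
          tauto
        have := eq_of_subset_of_card_le hsub2 hle
        show F c i ⊆ _
        rw [← this]; exact sdiff_subset
      -- Here the fibre is empty: the member chosen for any pair in it would lie inside the
      -- recoloured class.
      · refine ⟨∅, by simp, ?_⟩
        rintro ⟨i, c⟩ hp hpc
        exfalso
        apply hex
        simp only [hN, mem_filter, mem_univ, true_and] at hp
        obtain ⟨hs1, hs2, hs3⟩ := fragmentIndex_spec (T c) (G c) (colourClass c {q}) i hp.1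
        have hFs : F c i ⊆ T c (fragmentIndex (T c) (G c) (colourClass c {q}) i) := sdiff_subset
        have hcc : ∀ x, ∀ q' ∈ Q, c x = q' ↔ c' x = q' := by
          intro x q' hq'
          rw [← hpc]
          simp only [hrec]
          split_ifs with hx
          · have := hst.avoids c _ hs1 x (hFs hx)
            constructor
            · rintro rfl; exact absurd hq' this
            · rintro rfl; exact absurd hq' hq
          · rfl
        obtain ⟨hT, hG⟩ := hst.congr c c' hcc
        refine ⟨fragmentIndex (T c) (G c) (colourClass c {q}) i, hG ▸ hs1, ?_⟩
        rw [← hT]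
        intro x hx
        rw [← hpc]
        simp only [colourClass, hrec, mem_filter, mem_univ, true_and, mem_singleton]
        split_ifs with h
        · rfl
        · simp only [hF, mem_sdiff, not_and, not_not] at h
          have := h hx
          simpa [colourClass] using this
    set 𝒯 : Finset (Finset X) := {t ∈ V.powerset | w / 2 < #t} with h𝒯
    -- Given the fragment `t`, the index satisfies `t ⊆ S i` and the original colouring agrees with
    -- `c'` off `t`.
    have hsub : {p ∈ N | rec p = c'} ⊆ 𝒯.biUnion fun t => ({i | t ⊆ S i} : Finset ι) ×ˢ
        Fintype.piFinset (fun x => if x ∈ t then (univ : Finset C) else {c' x}) := by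
      rintro ⟨i, c⟩ hp
      rw [mem_filter] at hp
      obtain ⟨hpN, hpc⟩ := hp
      have hpN' := hpN
      simp only [hN, mem_filter, mem_univ, true_and] at hpN'
      rw [mem_biUnion]
      refine ⟨F c i, ?_, ?_⟩
      · simp only [h𝒯, mem_filter, mem_powerset]
        exact ⟨hV _ hpN hpc, hpN'.2⟩
      · simp only [mem_product, mem_filter, mem_univ, true_and, Fintype.mem_piFinset]
        constructor
        · obtain ⟨hs1, hs2, hs3⟩ := fragmentIndex_spec (T c) (G c) (colourClass c {q}) i hpN'.1
          refine Subset.trans ?_ (hst.subset c i hpN'.1)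
          intro x hx
          simp only [hF, mem_sdiff] at hx
          have := hs2 hx.1
          simp only [mem_union] at this
          tauto
        · intro x
          split_ifs with hx
          · simp
          · rw [← hpc]; simp [hrec, hx]
    have hcount : #{p ∈ N | rec p = c'} * M ^ (w / 2 + 1) ≤ 4 ^ (w / 2 + 1) * Fintype.card ι := by
      calc #{p ∈ N | rec p = c'} * M ^ (w / 2 + 1)
          ≤ (∑ t ∈ 𝒯, #(({i | t ⊆ S i} : Finset ι) ×ˢ
        Fintype.piFinset (fun x => if x ∈ t then (univ : Finset C) else {c' x}))) *
            M ^ (w / 2 + 1) := by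
            gcongr
            exact (card_le_card hsub).trans card_biUnion_le
        _ ≤ ∑ t ∈ 𝒯, Fintype.card ι := by
            rw [sum_mul]
            refine sum_le_sum fun t ht => ?_
            refine le_trans ?_ (card_pairs_le S M hspread t c')
            simp only [h𝒯, mem_filter] at ht
            gcongr
            · omega
            · exact ht.2
        _ = #𝒯 * Fintype.card ι := by simp
        _ ≤ 4 ^ (w / 2 + 1) * Fintype.card ι := by
            gcongr
            calc #𝒯 ≤ #V.powerset := card_filter_le _ _
              _ = 2 ^ #V := card_powerset _
              _ ≤ 2 ^ (2 * (w / 2 + 1)) := by gcongr; · norm_num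
                                              · omega
              _ = 4 ^ (w / 2 + 1) := by rw [pow_mul]; norm_num
    have hpow : 4 ^ (w / 2) ≤ M ^ (w / 2) := Nat.pow_le_pow_left hM _
    have h4 : 0 < 4 ^ (w / 2) := by positivity
    refine Nat.le_of_mul_le_mul_left ?_ h4
    calc 4 ^ (w / 2) * (#{p ∈ N | rec p = c'} * M)
        ≤ M ^ (w / 2) * (#{p ∈ N | rec p = c'} * M) := by gcongr
      _ = #{p ∈ N | rec p = c'} * M ^ (w / 2 + 1) := by ring
      _ ≤ _ := hcount
      _ = 4 ^ (w / 2) * (4 * Fintype.card ι) := by ring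
  have hsum : #N = ∑ c' : X → C, #{p ∈ N | rec p = c'} :=
    card_eq_sum_card_fiberwise (fun _ _ => by simp)
  show #N * M ≤ _
  rw [hsum, sum_mul]
  calc _ ≤ ∑ c' : X → C, 4 * Fintype.card ι := sum_le_sum fun c' _ => hfib c'
    _ = _ := by simp [Finset.card_univ]; ring

/-- The fragments become the new sets, and indices whose fragment exceeds half the old size bound
are abandoned; `card_large_fragments_le` pays for that loss. -/
theorem FragmentStage.next {S : ι → Finset X} {Q : Finset C} {w M j : ℕ}
    {T : (X → C) → ι → Finset X} {G : (X → C) → Finset ι}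
    (hst : FragmentStage S Q w M j T G) (hM : 4 ≤ M)
    (hspread : ∀ Z : Finset X, #{i | Z ⊆ S i} * (Fintype.card C * M) ^ #Z ≤ Fintype.card ι)
    {q : C} (hq : q ∉ Q) :
    ∃ T' G', FragmentStage S (insert q Q) (w / 2) M (j + 1) T' G' := by
  classical
  set F : (X → C) → ι → Finset X := fun c i =>
    T c (fragmentIndex (T c) (G c) (colourClass c {q}) i) \ colourClass c {q} with hF
  have hFi : ∀ c, ∀ i ∈ G c, F c i ⊆ T c i := by
    intro c i hi x hx
    obtain ⟨hs1, hs2, hs3⟩ := fragmentIndex_spec (T c) (G c) (colourClass c {q}) i hi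
    simp only [hF, mem_sdiff] at hx
    have := hs2 hx.1
    simp only [mem_union] at this
    tauto
  refine ⟨F, fun c => {i ∈ G c | #(F c i) ≤ w / 2}, ?_, ?_, ?_, ?_, ?_, ?_⟩
  · intro c i hi
    rw [mem_filter] at hi
    exact (hFi c i hi.1).trans (hst.subset c i hi.1)
  · intro c i hi
    rw [mem_filter] at hi
    obtain ⟨hs1, hs2, hs3⟩ := fragmentIndex_spec (T c) (G c) (colourClass c {q}) i hi.1
    obtain ⟨i', hi'⟩ := hst.covers c _ hs1
    refine ⟨i', fun x hx => ?_⟩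
    have := hi' hx
    simp only [hF, mem_union, mem_sdiff, colourClass, mem_filter, mem_univ, true_and,
      mem_singleton, mem_insert] at this ⊢
    tauto
  · intro c i hi x hx
    rw [mem_filter] at hi
    have h1 := hst.avoids c i hi.1 x (hFi c i hi.1 hx)
    simp only [hF, mem_sdiff, colourClass, mem_filter, mem_univ, true_and, mem_singleton] at hx
    simp only [mem_insert, not_or]
    exact ⟨hx.2, h1⟩
  · intro c i hi
    rw [mem_filter] at hi
    exact hi.2
  · intro c c' hcc
    obtain ⟨hT, hG⟩ := hst.congr c c' fun x q' hq' => hcc x q' (mem_insert_of_mem hq')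
    have hW : colourClass c {q} = colourClass c' {q} := by
      ext x
      simpa [colourClass] using hcc x q (mem_insert_self _ _)
    have hFF : F c = F c' := by
      simp only [hF, hT, hG, hW]
    exact ⟨hFF, by simp only [hFF, hG]⟩
  · have h1 := hst.lost
    have h2 := card_large_fragments_le hst hM hspread hq
    have h3 : #{p : ι × (X → C) | p.1 ∉ {i ∈ G p.2 | #(F p.2 i) ≤ w / 2}} ≤
        #{p : ι × (X → C) | p.1 ∉ G p.2} +
        #{p : ι × (X → C) | p.1 ∈ G p.2 ∧ w / 2 < #(F p.2 p.1)} := by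
      refine le_trans (card_le_card ?_) (card_union_le _ _)
      intro p hp
      simp only [mem_filter, mem_univ, true_and, mem_union, not_and, not_le] at hp ⊢
      tauto
    calc _ ≤ (#{p : ι × (X → C) | p.1 ∉ G p.2} +
        #{p : ι × (X → C) | p.1 ∈ G p.2 ∧ w / 2 < #(F p.2 p.1)}) * M :=
          Nat.mul_le_mul_right _ h3
      _ ≤ _ := by rw [add_mul]; exact (add_le_add h1 h2).trans (by ring_nf; rfl)

/-- A random colour class union of a spread family contains a member with probability at
least one half. -/
theorem spread_colouring {S : ι → Finset X} {w J : ℕ} (hw : ∀ i, #(S i) ≤ w) (hJ : w < 2 ^ J)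
    (hJ1 : 1 ≤ J) (hι : 0 < Fintype.card ι)
    (hspread : ∀ Z : Finset X,
      #{i | Z ⊆ S i} * (Fintype.card C * (8 * J)) ^ #Z ≤ Fintype.card ι)
    (Q : Finset C) (hQ : #Q = J) :
    2 * #{c : X → C | ¬ ∃ i, S i ⊆ colourClass c Q} ≤ Fintype.card C ^ Fintype.card X := by
  classical
  have key : ∀ Q' : Finset C, ∃ T G, FragmentStage S Q' (w / 2 ^ #Q') (8 * J) #Q' T G := by
    intro Q'
    induction Q' using Finset.induction_on with
    | empty =>
      refine ⟨fun _ => S, fun _ => univ, ?_, ?_, ?_, ?_, ?_, ?_⟩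
      · intro c i _; exact Subset.rfl
      · intro c i _; exact ⟨i, subset_union_left⟩
      · simp
      · intro c i _; simpa using hw i
      · simp
      · simp
    | insert q Q' hq ih =>
      obtain ⟨T, G, h⟩ := ih
      obtain ⟨T', G', h'⟩ := h.next (by omega) hspread hq
      refine ⟨T', G', ?_⟩
      rw [card_insert_of_notMem hq, pow_succ, ← Nat.div_div_eq_div_mul]
      exact h'
  obtain ⟨T, G, h⟩ := key Q
  -- After `J` halvings the size bound is zero, so every surviving index witnesses a member inside
  -- the exposed classes. With `M = 8 * J`, at most half of all pairs have been lost.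
  rw [hQ, Nat.div_eq_of_lt hJ] at h
  have hsub : (univ : Finset ι) ×ˢ ({c : X → C | ¬ ∃ i, S i ⊆ colourClass c Q} : Finset (X → C)) ⊆
      ({p : ι × (X → C) | p.1 ∉ G p.2} : Finset (ι × (X → C))) := by
    rintro ⟨i, c⟩ hp
    simp only [mem_product, mem_univ, mem_filter, true_and] at hp ⊢
    intro hi
    apply hp
    obtain ⟨i', hi'⟩ := h.covers c i hi
    have h0 : T c i = ∅ := by
      have := h.card_le c i hi
      simpa using this
    exact ⟨i', by simpa [h0] using hi'⟩
  have h1 := card_le_card hsub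
  rw [card_product, card_univ] at h1
  have h2 := (Nat.mul_le_mul_right (8 * J) h1).trans h.lost
  have h3 : 0 < 4 * J * Fintype.card ι := by positivity
  refine Nat.le_of_mul_le_mul_left ?_ h3
  calc _ = Fintype.card ι * #{c : X → C | ¬ ∃ i, S i ⊆ colourClass c Q} * (8 * J) := by ring
    _ ≤ _ := h2
    _ = _ := by ring

/-- A spread family contains many pairwise disjoint members. -/
theorem exists_disjoint_of_spread {S : ι → Finset X} {w J r : ℕ} (hw : ∀ i, #(S i) ≤ w)
    (hJ : w < 2 ^ J) (hJ1 : 1 ≤ J) (hr : 1 ≤ r) (hι : 0 < Fintype.card ι)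
    (hspread : ∀ Z : Finset X, #{i | Z ⊆ S i} * (16 * r * J ^ 2) ^ #Z ≤ Fintype.card ι) :
    ∃ f : Fin r → ι, Pairwise fun a b => Disjoint (S (f a)) (S (f b)) := by
  classical
  -- The colours form `2 * r` blocks of `J`. Each block fails with probability at most one half, so
  -- some colouring has at least `r` good blocks, and different blocks give disjoint members.
  set bad : Fin (2 * r) → Finset (X → Fin (2 * r) × Fin J) := fun l =>
    {c | ¬ ∃ i, S i ⊆ colourClass c (({l} : Finset (Fin (2 * r))) ×ˢ univ)} with hbad
  have hK : Fintype.card (Fin (2 * r) × Fin J) = 2 * r * J := by simp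
  have hb : ∀ l, 2 * #(bad l) ≤ (2 * r * J) ^ Fintype.card X := by
    intro l
    rw [← hK]
    refine spread_colouring hw hJ hJ1 hι ?_ _ (by simp)
    intro Z
    rw [hK]
    refine le_trans (le_of_eq ?_) (hspread Z)
    ring
  obtain ⟨c, hc⟩ : ∃ c : X → Fin (2 * r) × Fin J, #{l | c ∈ bad l} ≤ r := by
    by_contra! hcon
    have hdc : ∑ c : X → Fin (2 * r) × Fin J, #{l | c ∈ bad l} = ∑ l, #(bad l) := by
      have := sum_card_bipartiteAbove_eq_sum_card_bipartiteBelow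
        (s := (univ : Finset (X → Fin (2 * r) × Fin J))) (t := (univ : Finset (Fin (2 * r))))
        (fun c l => c ∈ bad l)
      simp only [bipartiteAbove, bipartiteBelow] at this
      rw [this]
      refine sum_congr rfl fun l _ => ?_
      congr 1; ext c; simp
    have h1 : ∑ c : X → Fin (2 * r) × Fin J, (r + 1) ≤ ∑ l, #(bad l) := by
      rw [← hdc]; exact sum_le_sum fun c _ => hcon c
    have h2 : 2 * ∑ l, #(bad l) ≤ 2 * r * (2 * r * J) ^ Fintype.card X := by
      rw [mul_sum]
      refine (sum_le_sum fun l _ => hb l).trans ?_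
      simp
    simp only [sum_const, card_univ, Fintype.card_fun, hK, smul_eq_mul] at h1
    have hpos : 0 < (2 * r * J) ^ Fintype.card X := by positivity
    nlinarith
  have hgood : r ≤ #{l | c ∉ bad l} := by
    have := card_filter_add_card_filter_not (s := (univ : Finset (Fin (2 * r)))) (fun l => c ∈ bad l)
    simp only [card_univ, Fintype.card_fin] at this
    omega
  obtain ⟨L, hL, hLr⟩ := exists_subset_card_eq hgood
  have e : Fin r ≃ L := (Fintype.equivFinOfCardEq (by simpa using hLr)).symm
  have hex : ∀ a : Fin r, ∃ i, S i ⊆ colourClass c (({(e a).1} : Finset (Fin (2 * r))) ×ˢ univ) := by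
    intro a
    have := hL (e a).2
    simpa [hbad] using this
  choose f hf using hex
  refine ⟨f, fun a b hab => ?_⟩
  refine disjoint_left.mpr fun x hxa hxb => ?_
  have h1 := hf a hxa
  have h2 := hf b hxb
  simp only [colourClass, mem_filter, mem_univ, true_and, mem_product, mem_singleton,
    and_true] at h1 h2
  exact hab (e.injective (Subtype.ext (h1.symm.trans h2)))

end

/-- A sunflower lemma with bound `(C r log ^ 2 w) ^ w`. -/
theorem exists_sunflower {X : Type*} [Fintype X] [DecidableEq X] (F : Finset (Finset X))
    {w J r : ℕ} (hw : ∀ S ∈ F, #S = w) (hJ : w < 2 ^ J) (hJ1 : 1 ≤ J) (hr : 1 ≤ r)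
    (hF : (16 * r * J ^ 2) ^ w < #F) :
    ∃ (Z : Finset X) (f : Fin r → Finset X), (∀ a, f a ∈ F ∧ Z ⊂ f a) ∧
      Pairwise fun a b => Disjoint (f a \ Z) (f b \ Z) := by
  classical
  set R := 16 * r * J ^ 2 with hR
  have hR1 : 1 ≤ R := by
    have : 0 < R := by positivity
    exact this
  -- A kernel maximising this weight has a spread link: enlarging it by `Y` cannot increase the
  -- weight.
  obtain ⟨Z, -, hZ⟩ := exists_max_image (univ : Finset (Finset X))
    (fun Z => #{S ∈ F | Z ⊆ S} * R ^ #Z) ⟨∅, mem_univ _⟩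
  set FZ := {S ∈ F | Z ⊆ S} with hFZ
  have hbig : R ^ w < #FZ * R ^ #Z := by
    have := hZ ∅ (mem_univ _)
    simp only [empty_subset, filter_true, card_empty, pow_zero, mul_one] at this
    exact hF.trans_le this
  have hpos : 0 < #FZ := by
    rcases Nat.eq_zero_or_pos #FZ with h | h
    · simp [h] at hbig
    · exact h
  -- If the kernel were a member, uniformity would make it the only one above itself, of weight `R ^
  -- w`, which is too small.
  have hne : ∀ S ∈ FZ, Z ≠ S := by
    rintro S hS rfl
    simp only [hFZ, mem_filter] at hS
    have h1 : FZ ⊆ {Z} := by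
      intro S' hS'
      simp only [hFZ, mem_filter] at hS'
      rw [mem_singleton]
      exact (eq_of_subset_of_card_le hS'.2 (by rw [hw _ hS'.1, hw _ hS.1])).symm
    have h2 := card_le_card h1
    rw [card_singleton] at h2
    rw [hw _ hS.1] at hbig
    have : #FZ * R ^ w ≤ 1 * R ^ w := Nat.mul_le_mul_right _ h2
    omega
  have hspread : ∀ Y : Finset X,
      #{i : FZ | Y ⊆ i.1 \ Z} * (16 * r * J ^ 2) ^ #Y ≤ Fintype.card FZ := by
    intro Y
    rw [← hR, Fintype.card_coe]
    by_cases hYZ : Disjoint Y Z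
    · have h1 : #{i : FZ | Y ⊆ i.1 \ Z} ≤ #{S ∈ F | Z ∪ Y ⊆ S} := by
        refine card_le_card_of_injOn (fun i => i.1) ?_ (fun a _ b _ h => Subtype.ext h)
        rintro ⟨S, hS⟩ h
        simp only [hFZ, mem_filter] at hS
        simp only [coe_filter, mem_univ, true_and, Set.mem_ofPred_eq] at h ⊢
        exact ⟨hS.1, union_subset hS.2 (h.trans sdiff_subset)⟩
      have h2 := hZ (Z ∪ Y) (mem_univ _)
      rw [card_union_of_disjoint hYZ.symm, pow_add] at h2
      have h3 : 0 < R ^ #Z := by positivity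
      refine Nat.le_of_mul_le_mul_right ?_ h3
      calc _ ≤ #{S ∈ F | Z ∪ Y ⊆ S} * R ^ #Y * R ^ #Z := by gcongr
        _ = #{S ∈ F | Z ∪ Y ⊆ S} * (R ^ #Z * R ^ #Y) := by ring
        _ ≤ _ := h2
    · have : #{i : FZ | Y ⊆ i.1 \ Z} = 0 := by
        rw [card_eq_zero, filter_eq_empty_iff]
        intro i _ h
        exact hYZ (disjoint_sdiff.symm.mono_left h)
      rw [this]; simp
  obtain ⟨f, hf⟩ := exists_disjoint_of_spread (S := fun i : FZ => i.1 \ Z) (w := w) (J := J) (r := r)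
    (fun i => (card_le_card sdiff_subset).trans (hw _ (mem_filter.mp i.2).1).le) hJ hJ1 hr
    (by rw [Fintype.card_coe]; exact hpos) hspread
  refine ⟨Z, fun a => (f a).1, fun a => ?_, hf⟩
  have := mem_filter.mp (f a).2
  exact ⟨this.1, this.2.ssubset_of_ne (hne _ (f a).2)⟩

/-! ### Matchings, and regular subhypergraphs from sunflowers of matchings. -/

section
variable {α : Type*} [DecidableEq α]

/-- The number of members of `E` containing `v`. -/
def edgeDegree (E : Finset (Finset α)) (v : α) : ℕ := #{e ∈ E | v ∈ e}

/-- The matchings with `w` edges contained in `E`. -/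
def matchingsOfCard (E : Finset (Finset α)) (w : ℕ) : Finset (Finset (Finset α)) :=
  {M ∈ E.powersetCard w | ∀ e ∈ M, ∀ f ∈ M, e ≠ f → Disjoint e f}

theorem mem_matchingsOfCard {E : Finset (Finset α)} {w : ℕ} {M : Finset (Finset α)} :
    M ∈ matchingsOfCard E w ↔ M ⊆ E ∧ #M = w ∧ ∀ e ∈ M, ∀ f ∈ M, e ≠ f → Disjoint e f := by
  simp [matchingsOfCard, and_assoc]

/-- There are many ways to extend a matching by an edge. -/
theorem le_card_disjoint_edges {E M : Finset (Finset α)} {k Δ b w : ℕ} (hM : #M ≤ w)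
    (hk : ∀ f ∈ M, #f ≤ k) (hΔ : ∀ v, edgeDegree E v ≤ Δ) (hb : b + w * k * Δ ≤ #E) :
    b ≤ #{e ∈ E | ∀ f ∈ M, Disjoint e f} := by
  have h1 : #{e ∈ E | ¬ ∀ f ∈ M, Disjoint e f} ≤ w * k * Δ := by
    calc _ ≤ #(M.biUnion fun f => f.biUnion fun v => {e ∈ E | v ∈ e}) := by
          refine card_le_card fun e he => ?_
          simp only [mem_filter, not_forall] at he
          obtain ⟨heE, f, hf, hd⟩ := he
          obtain ⟨v, hv, hv'⟩ := not_disjoint_iff.mp hd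
          simp only [mem_biUnion, mem_filter]
          exact ⟨f, hf, v, hv', heE, hv⟩
      _ ≤ ∑ f ∈ M, ∑ v ∈ f, Δ := by
          refine card_biUnion_le.trans (sum_le_sum fun f _ => ?_)
          exact card_biUnion_le.trans (sum_le_sum fun v _ => hΔ v)
      _ ≤ ∑ f ∈ M, k * Δ := by
          refine sum_le_sum fun f hf => ?_
          rw [sum_const, smul_eq_mul]
          exact Nat.mul_le_mul_right _ (hk f hf)
      _ ≤ w * k * Δ := by
          rw [sum_const, smul_eq_mul, mul_assoc]
          exact Nat.mul_le_mul_right _ hM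
  have h2 := card_filter_add_card_filter_not (s := E) (fun e => ∀ f ∈ M, Disjoint e f)
  omega

/-- A lower bound for the number of matchings of a given size. -/
theorem pow_le_card_matchingsOfCard_mul {E : Finset (Finset α)} {k Δ b w : ℕ}
    (hne : ∀ e ∈ E, e.Nonempty) (hk : ∀ e ∈ E, #e ≤ k) (hΔ : ∀ v, edgeDegree E v ≤ Δ)
    (hb : b + w * k * Δ ≤ #E) :
    ∀ j ≤ w, b ^ j ≤ #(matchingsOfCard E j) * j.factorial := by
  intro j
  induction j with
  | zero =>
    intro _
    have : ∅ ∈ matchingsOfCard E 0 := by simp [mem_matchingsOfCard]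
    simpa using card_pos.mpr ⟨_, this⟩
  | succ j ih =>
    intro hj
    have ih' := ih (by omega)
    -- Double counting of larger matchings with a distinguished edge; this produces the factorial.
    set P := (matchingsOfCard E j).sigma fun M => {e ∈ E | ∀ f ∈ M, Disjoint e f} with hP
    set P' := (matchingsOfCard E (j + 1)).sigma fun M => M with hP'
    have h1 : #(matchingsOfCard E j) * b ≤ #P := by
      rw [hP, card_sigma, ← smul_eq_mul, ← sum_const]
      refine sum_le_sum fun M hM => ?_
      rw [mem_matchingsOfCard] at hM
      exact le_card_disjoint_edges (by omega) (fun f hf => hk f (hM.1 hf)) hΔ hb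
    have h2 : #P' = #(matchingsOfCard E (j + 1)) * (j + 1) := by
      rw [hP', card_sigma, ← smul_eq_mul, ← sum_const]
      refine sum_congr rfl fun M hM => ?_
      exact (mem_matchingsOfCard.mp hM).2.1
    have hnot : ∀ p ∈ P, p.2 ∉ p.1 := by
      rintro ⟨M, e⟩ hp he
      simp only [hP, mem_sigma, mem_filter] at hp
      have := hp.2.2 e he
      rw [disjoint_self] at this
      have h := hne e hp.2.1
      simp [this] at h
    have h3 : #P ≤ #P' := by
      refine card_le_card_of_injOn
        (fun p => (⟨insert p.2 p.1, p.2⟩ : (_ : Finset (Finset α)) × Finset α)) ?_ ?_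
      · rintro ⟨M, e⟩ hp
        have hn := hnot _ hp
        simp only [hP, coe_sigma, Set.mem_sigma_iff, mem_coe, mem_filter] at hp
        simp only [hP', coe_sigma, Set.mem_sigma_iff, mem_coe, mem_insert_self, and_true]
        obtain ⟨hM, heE, hd⟩ := hp
        rw [mem_matchingsOfCard] at hM ⊢
        refine ⟨insert_subset heE hM.1, by rw [card_insert_of_notMem hn, hM.2.1], ?_⟩
        intro x hx y hy hxy
        rw [mem_insert] at hx hy
        rcases hx with rfl | hx <;> rcases hy with rfl | hy
        · exact absurd rfl hxy
        · exact hd y hy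
        · exact (hd x hx).symm
        · exact hM.2.2 x hx y hy hxy
      · rintro ⟨M, e⟩ hp ⟨M', e'⟩ hp' h
        simp only [Sigma.mk.injEq, heq_eq_eq] at h
        obtain ⟨h1, rfl⟩ := h
        have hn := hnot _ hp
        have hn' := hnot _ hp'
        have : M = M' := by
          simp only at hn hn'
          rw [← erase_insert hn, ← erase_insert hn', h1]
        rw [this]
    calc b ^ (j + 1) = b ^ j * b := pow_succ _ _
      _ ≤ #(matchingsOfCard E j) * j.factorial * b := Nat.mul_le_mul_right _ ih'
      _ = (#(matchingsOfCard E j) * b) * j.factorial := by ring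
      _ ≤ (#(matchingsOfCard E (j + 1)) * (j + 1)) * j.factorial :=
          Nat.mul_le_mul_right _ (by rw [← h2]; exact h1.trans h3)
      _ = _ := by rw [Nat.factorial_succ]; ring

/-- The petals of a sunflower of `r` matchings with the same vertex set form an `r`-regular
hypergraph. -/
theorem regular_of_sunflower {r : ℕ} {Z : Finset (Finset α)} {f : Fin r → Finset (Finset α)}
    {V : Finset α} (hZ : ∀ a, Z ⊆ f a)
    (hf : ∀ a, ∀ e ∈ f a, ∀ e' ∈ f a, e ≠ e' → Disjoint e e') (hV : ∀ a, (f a).biUnion id = V)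
    (hd : Pairwise fun a b => Disjoint (f a \ Z) (f b \ Z)) (v : α) :
    edgeDegree (univ.biUnion fun a => f a \ Z) v = 0 ∨
      edgeDegree (univ.biUnion fun a => f a \ Z) v = r := by
  unfold edgeDegree
  rw [filter_biUnion, card_biUnion]
  swap
  · intro a _ b _ hab
    exact (hd hab).mono (filter_subset _ _) (filter_subset _ _)
  -- Each petal covers exactly once the vertices of `V` missed by the kernel, and no others.
  by_cases hv : v ∈ V ∧ ∀ z ∈ Z, v ∉ z
  · right
    have : ∀ a, #{e ∈ f a \ Z | v ∈ e} = 1 := by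
      intro a
      have h1 := hv.1
      rw [← hV a, mem_biUnion] at h1
      obtain ⟨e, he, hve⟩ := h1
      rw [card_eq_one]
      refine ⟨e, ?_⟩
      ext e'
      simp only [mem_filter, mem_sdiff, mem_singleton, id] at hve ⊢
      constructor
      · rintro ⟨⟨he', -⟩, hve'⟩
        by_contra hne
        exact disjoint_left.mp (hf a e' he' e he hne) hve' hve
      · rintro rfl
        exact ⟨⟨he, fun hz => hv.2 _ hz hve⟩, hve⟩
    simp [this]
  · left
    refine sum_eq_zero fun a _ => ?_
    rw [card_eq_zero, filter_eq_empty_iff]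
    intro e he hve
    rw [mem_sdiff] at he
    apply hv
    refine ⟨?_, fun z hz hvz => ?_⟩
    · rw [← hV a, mem_biUnion]; exact ⟨e, he.1, hve⟩
    · have hne : e ≠ z := by rintro rfl; exact he.2 hz
      exact disjoint_left.mp (hf a e he.1 z (hZ a hz) hne) hve hvz

/-- If there is no `r`-regular subhypergraph then the matchings are few compared to their
possible vertex sets. -/
theorem card_matchingsOfCard_le [Fintype α] [Nonempty α] {E : Finset (Finset α)} {A : Finset α}
    {k w J r : ℕ} (hk : ∀ e ∈ E, #e = k) (hA : ∀ e ∈ E, ∃ v ∈ e, v ∈ A)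
    (hr : 1 ≤ r) (hJ1 : 1 ≤ J) (hJ : w < 2 ^ J)
    (hreg : ∀ S ⊆ E, (∀ v, edgeDegree S v = 0 ∨ edgeDegree S v = r) → S = ∅) :
    #(matchingsOfCard E w) ≤
      (#A).choose w * (Fintype.card α).choose ((k - 1) * w) * (16 * r * J ^ 2) ^ w := by
  classical
  by_contra! hcon
  choose! τ hτ using hA
  set V : Finset (Finset α) → Finset α := fun M => M.biUnion id with hVdef
  -- Splitting the vertex set into the marked vertices in `A` and the rest is what brings the size
  -- of `A` into the count.
  have hmaps : ∀ M ∈ matchingsOfCard E w, (fun M => (M.image τ, V M \ M.image τ)) M ∈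
      A.powersetCard w ×ˢ (univ : Finset α).powersetCard ((k - 1) * w) := by
    intro M hM
    rw [mem_matchingsOfCard] at hM
    obtain ⟨hME, hMw, hMd⟩ := hM
    have hinj : Set.InjOn τ M := by
      intro e he e' he' h
      by_contra hne
      exact disjoint_left.mp (hMd e he e' he' hne) (hτ e (hME he)).1
        (h ▸ (hτ e' (hME he')).1)
    have hcard : #(M.image τ) = w := by rw [card_image_of_injOn hinj, hMw]
    have hsub : M.image τ ⊆ V M := by
      intro v hv
      obtain ⟨e, he, rfl⟩ := mem_image.mp hv
      exact mem_biUnion.mpr ⟨e, he, (hτ e (hME he)).1⟩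
    have hVc : #(V M) = k * w := by
      have h : #(V M) = ∑ e ∈ M, #e := card_biUnion fun e he e' he' hne => hMd e he e' he' hne
      rw [h, sum_congr rfl (fun e he => hk e (hME he)), sum_const, hMw, smul_eq_mul, mul_comm]
    simp only [mem_product, mem_powersetCard, subset_univ, true_and]
    refine ⟨⟨?_, hcard⟩, ?_⟩
    · intro v hv
      obtain ⟨e, he, rfl⟩ := mem_image.mp hv
      exact (hτ e (hME he)).2
    · rw [card_sdiff_of_subset hsub, hVc, hcard, Nat.sub_mul, one_mul]
  obtain ⟨⟨A', B'⟩, -, hfib⟩ := exists_lt_card_fiber_of_mul_lt_card_of_maps_to hmaps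
    (n := (16 * r * J ^ 2) ^ w) (by
      rw [card_product, card_powersetCard, card_powersetCard, card_univ]; exact hcon)
  obtain ⟨Z, f, hf, hd⟩ := exists_sunflower _ (w := w)
    (fun M hM => (mem_matchingsOfCard.mp (mem_filter.mp hM).1).2.1) hJ hJ1 hr hfib
  have hf1 : ∀ a, f a ⊆ E ∧ #(f a) = w ∧ ∀ e ∈ f a, ∀ e' ∈ f a, e ≠ e' → Disjoint e e' :=
    fun a => mem_matchingsOfCard.mp (mem_filter.mp (hf a).1).1
  have hVf : ∀ a, (f a).biUnion id = A' ∪ B' := by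
    intro a
    have h := (mem_filter.mp (hf a).1).2
    simp only [Prod.mk.injEq] at h
    rw [← h.2, ← h.1]
    have hsub : (f a).image τ ⊆ V (f a) := by
      intro v hv
      obtain ⟨e, he, rfl⟩ := mem_image.mp hv
      exact mem_biUnion.mpr ⟨e, he, (hτ e ((hf1 a).1 he)).1⟩
    rw [union_sdiff_of_subset hsub]
  have hS := hreg (univ.biUnion fun a => f a \ Z)
    (biUnion_subset.mpr fun a _ => sdiff_subset.trans (hf1 a).1)
    (regular_of_sunflower (fun a => (hf a).2.subset) (fun a => (hf1 a).2.2) hVf hd)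
  obtain ⟨e, he, heZ⟩ := exists_of_ssubset (hf ⟨0, hr⟩).2
  have : e ∈ univ.biUnion fun a => f a \ Z :=
    mem_biUnion.mpr ⟨⟨0, hr⟩, mem_univ _, mem_sdiff.mpr ⟨he, heZ⟩⟩
  simp [hS] at this

end

/-! ### The upper bound for families of finite sets. -/

/-- The bound `C(x, y) ≤ (3x / y) ^ y`. -/
theorem choose_mul_pow_self_le (x y : ℕ) : x.choose y * y ^ y ≤ (3 * x) ^ y := by
  have h1 : ((x.choose y : ℕ) : ℝ) ≤ (x : ℝ) ^ y / y.factorial := Nat.choose_le_pow_div y x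
  have h2 : (y : ℝ) ^ y / y.factorial ≤ 3 ^ y := by
    refine (Real.pow_div_factorial_le_exp (y : ℝ) (Nat.cast_nonneg y) y).trans ?_
    rw [← mul_one (y : ℝ), Real.exp_nat_mul]
    gcongr
    exact Real.exp_one_lt_three.le
  have h3 : (0 : ℝ) < y.factorial := by positivity
  have : ((x.choose y * y ^ y : ℕ) : ℝ) ≤ ((3 * x) ^ y : ℕ) := by
    push_cast
    calc (x.choose y : ℝ) * (y : ℝ) ^ y ≤ (x : ℝ) ^ y / y.factorial * (y : ℝ) ^ y := by gcongr
      _ = (x : ℝ) ^ y * ((y : ℝ) ^ y / y.factorial) := by ring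
      _ ≤ (x : ℝ) ^ y * 3 ^ y := by gcongr
      _ = (3 * (x : ℝ)) ^ y := by rw [mul_pow]; ring
  exact_mod_cast this

/-- This is the `w`-th root of the comparison between the two bounds for the number of matchings.
The factor `w!`, at most `w ^ w`, is cancelled by the denominator of the binomial for `A`; the other
binomial supplies `w ^ (k - 1)`. -/
theorem card_class_bound {α : Type*} [DecidableEq α] [Fintype α] [Nonempty α] {E : Finset (Finset α)}
    {A : Finset α} {k w J r b Δ : ℕ} (hk1 : 1 ≤ k) (hk : ∀ e ∈ E, #e = k)
    (hA : ∀ e ∈ E, ∃ v ∈ e, v ∈ A) (hr : 1 ≤ r) (hJ1 : 1 ≤ J) (hJ : w < 2 ^ J) (hw : 1 ≤ w)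
    (hΔ : ∀ v, edgeDegree E v ≤ Δ) (hb : b + w * k * Δ ≤ #E)
    (hreg : ∀ S ⊆ E, (∀ v, edgeDegree S v = 0 ∨ edgeDegree S v = r) → S = ∅) :
    b * w ^ (k - 1) ≤ 3 * #A * (3 * Fintype.card α) ^ (k - 1) * (16 * r * J ^ 2) := by
  set n := Fintype.card α
  set R := 16 * r * J ^ 2
  have h1 := pow_le_card_matchingsOfCard_mul
    (fun e he => card_pos.mp (by rw [hk e he]; exact hk1)) (fun e he => (hk e he).le) hΔ hb w le_rfl
  have h2 := card_matchingsOfCard_le hk hA hr hJ1 hJ hreg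
  have h3 : w.factorial ≤ w ^ w := Nat.factorial_le_pow w
  have h4 := choose_mul_pow_self_le #A w
  have h5 := choose_mul_pow_self_le n ((k - 1) * w)
  rcases Nat.lt_or_ge k 2 with hk2 | hk2
  · obtain rfl : k = 1 := by omega
    simp only [Nat.sub_self, pow_zero, mul_one, zero_mul, Nat.choose_zero_right] at h2 ⊢
    have h6 : b ^ w ≤ (3 * #A * R) ^ w := by
      calc b ^ w ≤ ((#A).choose w * R ^ w) * w ^ w := h1.trans (Nat.mul_le_mul h2 h3)
        _ = ((#A).choose w * w ^ w) * R ^ w := by ring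
        _ ≤ (3 * #A) ^ w * R ^ w := by gcongr
        _ = _ := by rw [← mul_pow]
    exact (Nat.pow_le_pow_iff_left (by omega)).mp h6
  · have h5' : n.choose ((k - 1) * w) * (w ^ (k - 1)) ^ w ≤ ((3 * n) ^ (k - 1)) ^ w := by
      rw [← pow_mul, ← pow_mul]
      refine le_trans ?_ h5
      gcongr
      exact Nat.le_mul_of_pos_left _ (by omega)
    have h6 : (b * w ^ (k - 1)) ^ w ≤ (3 * #A * (3 * n) ^ (k - 1) * R) ^ w := by
      calc (b * w ^ (k - 1)) ^ w = b ^ w * (w ^ (k - 1)) ^ w := mul_pow _ _ _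
        _ ≤ (((#A).choose w * n.choose ((k - 1) * w) * R ^ w) * w ^ w) * (w ^ (k - 1)) ^ w := by
            gcongr
            exact h1.trans (Nat.mul_le_mul h2 h3)
        _ = ((#A).choose w * w ^ w) * (n.choose ((k - 1) * w) * (w ^ (k - 1)) ^ w) * R ^ w := by
            ring
        _ ≤ (3 * #A) ^ w * ((3 * n) ^ (k - 1)) ^ w * R ^ w := by gcongr
        _ = _ := by rw [← mul_pow, ← mul_pow]
    exact (Nat.pow_le_pow_iff_left (by omega)).mp h6

theorem sum_edgeDegree {α : Type*} [DecidableEq α] [Fintype α] {E : Finset (Finset α)} {k : ℕ}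
    (hk : ∀ e ∈ E, #e = k) : ∑ v, edgeDegree E v = #E * k := by
  have := sum_card_bipartiteAbove_eq_sum_card_bipartiteBelow
    (s := (univ : Finset α)) (t := E) (fun v e => v ∈ e)
  simp only [bipartiteAbove, bipartiteBelow] at this
  unfold edgeDegree
  rw [this, ← smul_eq_mul, ← sum_const]
  refine sum_congr rfl fun e he => ?_
  rw [← hk e he]; congr 1; ext; simp

theorem edgeDegree_mono {α : Type*} [DecidableEq α] {E F : Finset (Finset α)} (h : E ⊆ F) (v : α) :
    edgeDegree E v ≤ edgeDegree F v := card_le_card (filter_subset_filter _ h)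

/-- Some dyadic class of edges, according to the largest degree of a vertex, is large. -/
theorem exists_dyadic_class {α : Type*} [DecidableEq α] {E : Finset (Finset α)} {n : ℕ}
    (hne : ∀ e ∈ E, e.Nonempty) (hn : ∀ v, edgeDegree E v ≤ n) :
    ∃ E' ⊆ E, ∃ D : ℕ, 1 ≤ D ∧ #E ≤ (Nat.log 2 n + 1) * #E' ∧
      (∀ v, edgeDegree E' v ≤ 2 * D) ∧ ∀ e ∈ E', ∃ v ∈ e, D ≤ edgeDegree E v := by
  classical
  set cls : Finset α → ℕ := fun e => Nat.log 2 (e.sup (edgeDegree E)) with hcls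
  obtain ⟨i, hi⟩ : ∃ i, #E ≤ (Nat.log 2 n + 1) * #{e ∈ E | cls e = i} := by
    by_contra! hcon
    have h1 : #E = ∑ i ∈ range (Nat.log 2 n + 1), #{e ∈ E | cls e = i} := by
      refine card_eq_sum_card_fiberwise fun e _ => ?_
      simp only [coe_range, Set.mem_Iio, hcls]
      exact Nat.lt_succ_of_le (Nat.log_mono_right (Finset.sup_le fun v _ => hn v))
    have h2 : ∑ i ∈ range (Nat.log 2 n + 1), (Nat.log 2 n + 1) * #{e ∈ E | cls e = i} <
        ∑ i ∈ range (Nat.log 2 n + 1), #E :=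
      sum_lt_sum_of_nonempty ⟨0, by simp⟩ fun i _ => hcon i
    rw [← mul_sum, ← h1] at h2
    simp at h2
  refine ⟨{e ∈ E | cls e = i}, filter_subset _ _, 2 ^ i, Nat.one_le_two_pow, hi, ?_, ?_⟩
  · intro v
    rcases Nat.eq_zero_or_pos (edgeDegree {e ∈ E | cls e = i} v) with h0 | h0
    · rw [h0]; exact Nat.zero_le _
    · obtain ⟨e, he⟩ := card_pos.mp h0
      simp only [mem_filter] at he
      have h1 : edgeDegree E v ≤ e.sup (edgeDegree E) := le_sup (f := edgeDegree E) he.2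
      have h2 := Nat.lt_pow_succ_log_self (b := 2) (by norm_num) (e.sup (edgeDegree E))
      have h3 : Nat.log 2 (e.sup (edgeDegree E)) = i := he.1.2
      rw [h3, pow_succ, mul_comm] at h2
      exact (edgeDegree_mono (filter_subset _ _) v).trans (h1.trans h2.le)
  · intro e he
    rw [mem_filter] at he
    obtain ⟨v, hv, hveq⟩ := exists_mem_eq_sup e (hne e he.1) (edgeDegree E)
    refine ⟨v, hv, ?_⟩
    rw [← hveq, ← he.2]
    refine Nat.pow_log_le_self 2 ?_
    rw [hveq]
    exact (card_pos.mpr ⟨e, mem_filter.mpr ⟨he.1, hv⟩⟩).ne'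

/-- The upper bound on the number of edges, in terms of natural numbers. -/
theorem card_edges_pow_le {α : Type*} [DecidableEq α] [Fintype α] {E : Finset (Finset α)}
    {k r : ℕ} (hk2 : 2 ≤ k) (hr : 1 ≤ r) (hk : ∀ e ∈ E, #e = k)
    (hn : ∀ v, edgeDegree E v ≤ Fintype.card α)
    (hreg : ∀ S ⊆ E, (∀ v, edgeDegree S v = 0 ∨ edgeDegree S v = r) → S = ∅) :
    #E ^ (k - 1) ≤ 96 * k * (24 * k) ^ (k - 1) * r *
      (Nat.log 2 (Fintype.card α) + 1) ^ (k + 2) * Fintype.card α ^ (2 * k - 3) := by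
  set n := Fintype.card α with hndef
  set L := Nat.log 2 n + 1 with hL
  have hne : ∀ e ∈ E, e.Nonempty := fun e he => card_pos.mp (by rw [hk e he]; omega)
  obtain ⟨E', hE', D, hD1, hEL, hΔ, hD⟩ := exists_dyadic_class hne hn
  obtain ⟨p, rfl⟩ : ∃ p, k = p + 2 := ⟨k - 2, by omega⟩
  have e1 : p + 2 - 1 = p + 1 := by omega
  have e2 : 2 * (p + 2) - 3 = p + (p + 1) := by omega
  rw [e1, e2]
  set k := p + 2 with hkdef
  rcases E'.eq_empty_or_nonempty with rfl | ⟨e₀, he₀⟩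
  · have : #E = 0 := by simpa using hEL
    rw [this]; simp
  have hDn : D ≤ n := by
    obtain ⟨v, -, hv⟩ := hD e₀ he₀
    exact hv.trans (hn v)
  have hn1 : 1 ≤ n := hD1.trans hDn
  have : Nonempty α := Fintype.card_pos_iff.mp hn1
  have hk' : ∀ e ∈ E', #e = k := fun e he => hk e (hE' he)
  -- With this `w` a matching blocks at most `w * k * (2 * D)` edges, no more than half of `E'`.
  set w := #E' / (4 * k * D) with hw
  have hpos : 0 < 4 * k * D := by positivity
  have hmain : #E' ^ (p + 1) ≤ 96 * k * (24 * k) ^ (p + 1) * r * L ^ 3 * n ^ (p + (p + 1)) := by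
    -- If `w = 0`, then `E'` has fewer than `4 * k * D` edges and `D ≤ n` already suffices.
    rcases Nat.eq_zero_or_pos w with h0 | hw1
    · rw [hw, Nat.div_eq_zero_iff] at h0
      have h1 : #E' ≤ 4 * k * n := by
        rcases h0 with h0 | h0
        · omega
        · exact h0.le.trans (by gcongr)
      calc #E' ^ (p + 1) ≤ (4 * k * n) ^ (p + 1) := by gcongr
        _ = 1 * (4 * k) ^ (p + 1) * 1 * 1 ^ 3 * (1 ^ p * n ^ (p + 1)) := by rw [mul_pow]; ring
        _ ≤ 96 * k * (24 * k) ^ (p + 1) * r * L ^ 3 * (n ^ p * n ^ (p + 1)) := by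
            gcongr
            · omega
            · omega
            · omega
        _ = _ := by rw [pow_add n p (p + 1)]
    have hwle : w * (4 * k * D) ≤ #E' := Nat.div_mul_le_self _ _
    have hwge : #E' ≤ 8 * k * D * w := by
      have h := Nat.lt_div_mul_add (a := #E') hpos
      rw [← hw] at h
      nlinarith [Nat.mul_le_mul_right (4 * k * D) hw1]
    have hsum' : #E' * k ≤ n * (2 * D) := by
      rw [← sum_edgeDegree hk']
      refine (sum_le_sum fun v _ => hΔ v).trans ?_
      simp [hndef]
    have hwn : w ≤ n := by
      have h1 : w * (4 * k * D) * k ≤ n * (2 * D) := (Nat.mul_le_mul_right _ hwle).trans hsum'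
      have h2 : w * (2 * D) ≤ w * (4 * k * D) * k := by
        have : 1 ≤ k := by omega
        calc w * (2 * D) = w * (2 * 1 * D) * 1 := by ring
          _ ≤ w * (4 * k * D) * k := by gcongr; omega
      exact Nat.le_of_mul_le_mul_right (h2.trans h1) (by positivity)
    set A : Finset α := {v | D ≤ edgeDegree E v} with hA
    have hAD : #A * D ≤ #E * k := by
      rw [← sum_edgeDegree hk, ← smul_eq_mul, ← sum_const]
      refine (sum_le_sum fun v hv => ?_).trans (sum_le_sum_of_subset (subset_univ A))
      exact (mem_filter.mp hv).2
    have hb := card_class_bound (E := E') (A := A) (k := k) (w := w) (J := L) (r := r)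
      (b := #E' - w * k * (2 * D)) (Δ := 2 * D) (by omega) hk'
      (fun e he => by
        obtain ⟨v, hv, hv'⟩ := hD e he
        exact ⟨v, hv, by simp [hA, hv']⟩) hr (by omega)
      (hwn.trans_lt (Nat.lt_pow_succ_log_self (by norm_num) n)) hw1 hΔ
      (by
        have : w * k * (2 * D) ≤ #E' := by nlinarith
        omega)
      (fun S hS => hreg S (hS.trans hE'))
    rw [e1, ← hndef] at hb
    have hb2 : #E' ≤ 2 * (#E' - w * k * (2 * D)) := by
      have : w * (4 * k * D) = 2 * (w * k * (2 * D)) := by ring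
      omega
    have hE'0 : 0 < #E' := card_pos.mpr ⟨e₀, he₀⟩
    -- Since `#A * D ≤ k * L * #E'`, the factor `#E'` cancels, leaving a bound for `w` alone.
    have hDw : D * w ^ (p + 1) ≤ 6 * k * L * (3 * n) ^ (p + 1) * (16 * r * L ^ 2) := by
      refine Nat.le_of_mul_le_mul_left ?_ hE'0
      calc #E' * (D * w ^ (p + 1)) ≤ 2 * (#E' - w * k * (2 * D)) * (D * w ^ (p + 1)) := by gcongr
        _ = 2 * D * ((#E' - w * k * (2 * D)) * w ^ (p + 1)) := by ring
        _ ≤ 2 * D * (3 * #A * (3 * n) ^ (p + 1) * (16 * r * L ^ 2)) := by gcongr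
        _ = 6 * (#A * D) * ((3 * n) ^ (p + 1) * (16 * r * L ^ 2)) := by ring
        _ ≤ 6 * (L * #E' * k) * ((3 * n) ^ (p + 1) * (16 * r * L ^ 2)) := by
            gcongr 6 * ?_ * _
            exact hAD.trans (by gcongr)
        _ = _ := by ring
    -- One factor `D` goes with `w ^ (p + 1)`; the remaining `D ^ p` is bounded by `n ^ p`.
    calc #E' ^ (p + 1) ≤ (8 * k * D * w) ^ (p + 1) := by gcongr
      _ = (8 * k) ^ (p + 1) * D ^ p * (D * w ^ (p + 1)) := by
          rw [mul_pow, mul_pow, pow_succ D]; ring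
      _ ≤ (8 * k) ^ (p + 1) * n ^ p * (6 * k * L * (3 * n) ^ (p + 1) * (16 * r * L ^ 2)) := by
          gcongr
      _ = _ := by
          have : (24 * k) ^ (p + 1) = (8 * k) ^ (p + 1) * 3 ^ (p + 1) := by
            rw [← mul_pow]; ring
          rw [this, mul_pow 3 n, pow_add n]; ring
  calc #E ^ (p + 1) ≤ (L * #E') ^ (p + 1) := by gcongr
    _ = L ^ (p + 1) * #E' ^ (p + 1) := mul_pow _ _ _
    _ ≤ L ^ (p + 1) * (96 * k * (24 * k) ^ (p + 1) * r * L ^ 3 * n ^ (p + (p + 1))) := by gcongr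
    _ = 96 * k * (24 * k) ^ (p + 1) * r * L ^ (p + 1 + 3) * n ^ (p + (p + 1)) := by ring

/-! ### Transfer to hypergraphs and to real exponents. -/

/-- The edges of a hypergraph on a finite type, as a finset of finsets. -/
noncomputable def finsetEdges {α : Type*} [Fintype α] (H : Hypergraph α) : Finset (Finset α) :=
  by classical exact {e | (e : Set α) ∈ H.edgeSet}

theorem mem_finsetEdges {α : Type*} [Fintype α] {H : Hypergraph α} {e : Finset α} :
    e ∈ finsetEdges H ↔ (e : Set α) ∈ H.edgeSet := by
  classical
  simp [finsetEdges]

theorem coe_image_finsetEdges {α : Type*} [Fintype α] (H : Hypergraph α) :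
    (fun e : Finset α => (e : Set α)) '' (finsetEdges H : Set (Finset α)) = H.edgeSet := by
  classical
  ext e
  simp only [Set.mem_image, mem_coe, mem_finsetEdges]
  constructor
  · rintro ⟨f, hf, rfl⟩; exact hf
  · intro he
    exact ⟨e.toFinset, by simpa using he, by simp⟩

theorem card_finsetEdges {α : Type*} [Fintype α] (H : Hypergraph α) :
    #(finsetEdges H) = H.edgeSet.ncard := by
  rw [← coe_image_finsetEdges, Set.ncard_image_of_injective _ coe_injective, Set.ncard_coe_finset]

/-- The hypergraph with a given finite set of edges, and no isolated vertices. -/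
def Hypergraph.ofFinset {α : Type*} (S : Finset (Finset α)) : Hypergraph α where
  vertexSet := {v | ∃ e ∈ S, v ∈ e}
  edgeSet := (fun e : Finset α => (e : Set α)) '' (S : Set (Finset α))
  subset_vertexSet_of_mem_edgeSet' := by
    rintro _ ⟨e, he, rfl⟩ v hv
    exact ⟨e, he, hv⟩

theorem Hypergraph.degree_ofFinset {α : Type*} [DecidableEq α] (S : Finset (Finset α)) (v : α) :
    (Hypergraph.ofFinset S).degree v = edgeDegree S v := by
  have : {e | e ∈ (Hypergraph.ofFinset S).edgeSet ∧ v ∈ e} =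
      (fun e : Finset α => (e : Set α)) '' (({e ∈ S | v ∈ e} : Finset (Finset α)) :
        Set (Finset α)) := by
    ext e
    simp only [Hypergraph.ofFinset, Set.mem_image, mem_coe, Set.mem_ofPred_eq, coe_filter]
    constructor
    · rintro ⟨⟨f, hf, rfl⟩, hv⟩
      exact ⟨f, ⟨hf, hv⟩, rfl⟩
    · rintro ⟨f, ⟨hf, hv⟩, rfl⟩
      exact ⟨⟨f, hf, rfl⟩, hv⟩
  rw [Hypergraph.degree, this, coe_injective.encard_image, Set.encard_coe_eq_coe_finsetCard]
  rfl

/-- By linearity the edges through `v` are disjoint apart from `v`, so picking another vertex from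
each is injective. -/
theorem edgeDegree_finsetEdges_le {α : Type*} [Fintype α] [DecidableEq α] {H : Hypergraph α} {k : ℕ}
    (hk : 2 ≤ k) (hu : ∀ e ∈ finsetEdges H, #e = k) (hl : H.IsLinear) (v : α) :
    edgeDegree (finsetEdges H) v ≤ Fintype.card α := by
  have hex : ∀ e ∈ finsetEdges H, ∃ u ∈ e, u ≠ v := by
    intro e he
    exact exists_mem_ne (by rw [hu e he]; omega) v
  have : Nonempty α := ⟨v⟩
  choose! u hu1 hu2 using hex
  rw [← card_univ]
  refine card_le_card_of_injOn u (by simp) ?_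
  intro e he f hf h
  simp only [coe_filter, Set.mem_ofPred_eq] at he hf
  by_contra hne
  have h1 := hl e (mem_finsetEdges.mp he.1) f (mem_finsetEdges.mp hf.1)
    (fun h => hne (coe_injective h))
  rw [Set.encard_le_one_iff] at h1
  exact hu2 e he.1 (h1 (u e) v ⟨hu1 e he.1, by rw [h]; exact hu1 f hf.1⟩ ⟨he.2, hf.2⟩)

theorem maxRegularFree_pow_le {k r n : ℕ} (hk : 2 ≤ k) (hr : 1 ≤ r) :
    Hypergraph.maxRegularFree k r n ^ (k - 1) ≤ 96 * k * (24 * k) ^ (k - 1) * r *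
      (Nat.log 2 n + 1) ^ (k + 2) * n ^ (2 * k - 3) := by
  obtain ⟨H, -, hu, hl, hreg, hm⟩ := (Hypergraph.isGreatest_maxRegularFree k r n hr).1
  rw [← hm, ← card_finsetEdges]
  have hu' : ∀ e ∈ finsetEdges H, #e = k := by
    intro e he
    have := hu e (mem_finsetEdges.mp he)
    rw [Set.encard_coe_eq_coe_finsetCard] at this
    exact_mod_cast this
  have := card_edges_pow_le hk hr hu' (edgeDegree_finsetEdges_le hk hu' hl) ?_
  · simpa using this
  intro S hS hd
  by_contra hne
  obtain ⟨e, he⟩ := nonempty_iff_ne_empty.mpr hne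
  apply hreg
  have hsub : (Hypergraph.ofFinset S).edgeSet ⊆ H.edgeSet := by
    rintro _ ⟨f, hf, rfl⟩
    exact mem_finsetEdges.mp (hS hf)
  refine ⟨Hypergraph.ofFinset S, ⟨?_, hsub⟩, ?_, ?_⟩
  · rintro v ⟨f, hf, hv⟩
    exact H.subset_vertexSet_of_mem_edgeSet' (mem_finsetEdges.mp (hS hf)) hv
  · obtain ⟨v, hv⟩ := card_pos.mp (by rw [hu' e (hS he)]; omega : 0 < #e)
    exact ⟨v, e, he, hv⟩
  · rintro v ⟨f, hf, hv⟩
    rw [Hypergraph.degree_ofFinset]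
    rcases hd v with h | h
    · have : 0 < edgeDegree S v := card_pos.mpr ⟨f, mem_filter.mpr ⟨hf, hv⟩⟩
      omega
    · rw [h]

/-- Both summands are at most `log n / log 2`, and `2 / log 2 < 3`. -/
theorem natLog_add_one_le {n : ℕ} (hn : 2 ≤ n) : ((Nat.log 2 n + 1 : ℕ) : ℝ) ≤ 3 * Real.log n := by
  have h2 : (0.6931471803 : ℝ) < Real.log 2 := Real.log_two_gt_d9
  have h3 : Real.log 2 ≤ Real.log n := Real.log_le_log (by norm_num) (by exact_mod_cast hn)
  have h4 : (Nat.log 2 n : ℝ) * Real.log 2 ≤ Real.log n := by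
    rw [← Real.log_pow]
    refine Real.log_le_log (by positivity) ?_
    exact_mod_cast Nat.pow_log_le_self 2 (by omega)
  push_cast
  have h5 : (Nat.log 2 n : ℝ) * 0.6931471803 ≤ Real.log n :=
    le_trans (by gcongr) h4
  nlinarith

theorem exists_upper_bound (k : ℕ) (hk : 2 ≤ k) :
    ∃ C₁ C₂ : ℝ, 0 < C₁ ∧ 0 < C₂ ∧ ∀ r n : ℕ, 1 ≤ r → 2 ≤ n →
      (Hypergraph.maxRegularFree k r n : ℝ) ≤
          C₁ * (r : ℝ) ^ (1 / ((k : ℝ) - 1)) *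
            (n : ℝ) ^ (2 - 1 / ((k : ℝ) - 1)) * Real.log (n : ℝ) ^ C₂ := by
  have hk1 : (0 : ℝ) < (k : ℝ) - 1 := by
    have : (2 : ℝ) ≤ k := by exact_mod_cast hk
    linarith
  set B : ℝ := 96 * k * (24 * k) ^ (k - 1) * 3 ^ (k + 2) with hB
  have hB0 : 0 < B := by
    have : (0 : ℝ) < k := by linarith
    positivity
  refine ⟨B ^ (1 / ((k : ℝ) - 1)), (k + 2) / ((k : ℝ) - 1), by positivity, by positivity, ?_⟩
  intro r n hr hn
  set m := Hypergraph.maxRegularFree k r n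
  have hlog : 0 < Real.log n := Real.log_pos (by exact_mod_cast hn)
  have h1 : (m : ℝ) ^ (k - 1) ≤ B * r * n ^ (2 * k - 3) * Real.log n ^ (k + 2) := by
    have h := maxRegularFree_pow_le (n := n) hk hr
    calc (m : ℝ) ^ (k - 1) ≤ ((96 * k * (24 * k) ^ (k - 1) * r *
      (Nat.log 2 n + 1) ^ (k + 2) * n ^ (2 * k - 3) : ℕ) : ℝ) := by exact_mod_cast h
      _ = 96 * k * (24 * k) ^ (k - 1) * r *
        ((Nat.log 2 n + 1 : ℕ) : ℝ) ^ (k + 2) * n ^ (2 * k - 3) := by push_cast; ring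
      _ ≤ 96 * k * (24 * k) ^ (k - 1) * r * (3 * Real.log n) ^ (k + 2) * n ^ (2 * k - 3) := by
          gcongr
          exact natLog_add_one_le hn
      _ = _ := by rw [hB, mul_pow]; ring
  have hcast : ((k - 1 : ℕ) : ℝ) = (k : ℝ) - 1 := by
    rw [Nat.cast_sub (by omega)]; simp
  have hcast2 : ((2 * k - 3 : ℕ) : ℝ) = 2 * (k : ℝ) - 3 := by
    rw [Nat.cast_sub (by omega)]; simp
  have h2 : (m : ℝ) = ((m : ℝ) ^ (k - 1)) ^ (1 / ((k : ℝ) - 1)) := by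
    rw [← Real.rpow_natCast, hcast, ← Real.rpow_mul (by positivity), mul_one_div_cancel hk1.ne',
      Real.rpow_one]
  rw [h2]
  refine (Real.rpow_le_rpow (by positivity) h1 (by positivity)).trans (le_of_eq ?_)
  rw [Real.mul_rpow (by positivity) (by positivity), Real.mul_rpow (by positivity) (by positivity),
    Real.mul_rpow (by positivity) (by positivity)]
  have h3 : ((n : ℝ) ^ (2 * k - 3)) ^ (1 / ((k : ℝ) - 1)) = (n : ℝ) ^ (2 - 1 / ((k : ℝ) - 1)) := by
    rw [← Real.rpow_natCast, hcast2, ← Real.rpow_mul (by positivity)]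
    congr 1
    field_simp
    ring
  have h4 : (Real.log n ^ (k + 2)) ^ (1 / ((k : ℝ) - 1)) =
      Real.log n ^ (((k : ℝ) + 2) / ((k : ℝ) - 1)) := by
    rw [← Real.rpow_natCast, ← Real.rpow_mul hlog.le]
    congr 1
    push_cast
    ring
  rw [h3, h4]

/-! ### The deletion method. -/

theorem sum_biUnion_le_sum_sum {ι β : Type*} [DecidableEq β] (s : Finset ι) (t : ι → Finset β)
    {g : β → ℝ} (hg : ∀ x, 0 ≤ g x) : ∑ x ∈ s.biUnion t, g x ≤ ∑ i ∈ s, ∑ x ∈ t i, g x := by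
  classical
  induction s using Finset.induction_on with
  | empty => simp
  | insert a s ha ih =>
    rw [biUnion_insert, sum_insert ha]
    have h1 := sum_union_inter (s₁ := t a) (s₂ := s.biUnion t) (f := g)
    have h2 : 0 ≤ ∑ x ∈ t a ∩ s.biUnion t, g x := sum_nonneg fun x _ => hg x
    linarith

/-- The number of colourings that give the colour `q` to all elements of `Q`. -/
theorem card_colourings_mul {X C : Type*} [Fintype X] [DecidableEq X] [Fintype C] [DecidableEq C]
    (q : C) (Q : Finset X) :
    #{c : X → C | ∀ x ∈ Q, c x = q} * Fintype.card C ^ #Q =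
      Fintype.card C ^ Fintype.card X := by
  have h1 : ({c : X → C | ∀ x ∈ Q, c x = q} : Finset (X → C)) =
      Fintype.piFinset fun x => if x ∈ Q then {q} else univ := by
    ext c
    simp only [mem_filter, mem_univ, true_and, Fintype.mem_piFinset]
    refine forall_congr' fun x => ?_
    split_ifs with h <;> simp [h]
  have h2 : ∀ x, #(if x ∈ Q then ({q} : Finset C) else univ) =
      if x ∈ Q then 1 else Fintype.card C := by
    intro x; split_ifs <;> simp [card_univ]
  rw [h1, Fintype.card_piFinset]
  simp only [h2]
  rw [prod_ite, prod_const_one, one_mul, prod_const, ← pow_add, ← card_univ (α := X)]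
  congr 1
  rw [← card_filter_add_card_filter_not (s := (univ : Finset X)) (fun x => x ∈ Q), add_comm]
  congr 2
  ext; simp

/-- The deletion method: a finite set of size `|E|` has a subset containing no member of `𝒬`, whose
size is at least the expected value for a random subset of density `1 / K` after deleting one point
from each member of `𝒬`. -/
theorem exists_independent {X : Type*} [Fintype X] [DecidableEq X] (E : Finset X)
    (𝒬 : Finset (Finset X)) (hne : ∀ Q ∈ 𝒬, Q.Nonempty) {K : ℕ} (hK : 1 ≤ K) :
    ∃ I ⊆ E, (∀ Q ∈ 𝒬, ¬ Q ⊆ I) ∧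
      (#E : ℝ) / K - ∑ Q ∈ 𝒬, (1 / (K : ℝ)) ^ #Q ≤ #I := by
  classical
  have hK0 : (0 : ℝ) < K := by exact_mod_cast hK
  set q : Fin K := ⟨0, hK⟩
  set cls : (X → Fin K) → Finset X := fun c => {x ∈ E | c x = q} with hcls
  set bad : (X → Fin K) → Finset (Finset X) := fun c => {Q ∈ 𝒬 | ∀ x ∈ Q, c x = q} with hbad
  have hcount : ∀ Q : Finset X, (#{c : X → Fin K | ∀ x ∈ Q, c x = q} : ℝ) =
      (K : ℝ) ^ Fintype.card X * (1 / (K : ℝ)) ^ #Q := by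
    intro Q
    have h := card_colourings_mul q Q
    rw [Fintype.card_fin] at h
    have h' : (#{c : X → Fin K | ∀ x ∈ Q, c x = q} : ℝ) * (K : ℝ) ^ #Q =
        (K : ℝ) ^ Fintype.card X := by exact_mod_cast h
    rw [← h', mul_assoc, ← mul_pow, mul_one_div_cancel hK0.ne', one_pow, mul_one]
  have hsum1 : ∑ c, (#(cls c) : ℝ) = (K : ℝ) ^ Fintype.card X * (#E / K) := by
    have h : ∑ c : X → Fin K, #(cls c) = ∑ x ∈ E, #{c : X → Fin K | c x = q} :=
      sum_card_bipartiteAbove_eq_sum_card_bipartiteBelow (fun (c : X → Fin K) x => c x = q)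
    have h' : ∑ c : X → Fin K, (#(cls c) : ℝ) = ∑ x ∈ E, (#{c : X → Fin K | c x = q} : ℝ) := by
      exact_mod_cast h
    rw [h']
    have : ∀ x ∈ E, (#{c : X → Fin K | c x = q} : ℝ) = (K : ℝ) ^ Fintype.card X * (1 / K) := by
      intro x _
      simpa using hcount {x}
    rw [sum_congr rfl this, sum_const, nsmul_eq_mul]
    ring
  have hsum2 : ∑ c, (#(bad c) : ℝ) =
      (K : ℝ) ^ Fintype.card X * ∑ Q ∈ 𝒬, (1 / (K : ℝ)) ^ #Q := by
    have h : ∑ c : X → Fin K, #(bad c) = ∑ Q ∈ 𝒬, #{c : X → Fin K | ∀ x ∈ Q, c x = q} :=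
      sum_card_bipartiteAbove_eq_sum_card_bipartiteBelow
        (fun (c : X → Fin K) (Q : Finset X) => ∀ x ∈ Q, c x = q)
    have h' : ∑ c : X → Fin K, (#(bad c) : ℝ) =
        ∑ Q ∈ 𝒬, (#{c : X → Fin K | ∀ x ∈ Q, c x = q} : ℝ) := by
      exact_mod_cast h
    rw [h', mul_sum]
    exact sum_congr rfl fun Q _ => hcount Q
  obtain ⟨c, -, hc⟩ : ∃ c ∈ (univ : Finset (X → Fin K)),
      (#E : ℝ) / K - ∑ Q ∈ 𝒬, (1 / (K : ℝ)) ^ #Q ≤ (#(cls c) : ℝ) - #(bad c) := by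
    refine exists_le_of_sum_le ⟨fun _ => q, mem_univ _⟩ ?_
    rw [sum_sub_distrib (fun c => (#(cls c) : ℝ)), hsum1, hsum2, sum_const, nsmul_eq_mul, card_univ, Fintype.card_fun,
      Fintype.card_fin]
    push_cast
    rw [mul_sub]
  -- The total choice function below needs a default point of `X`.
  rcases isEmpty_or_nonempty X with hX | hX
  · refine ⟨∅, empty_subset _, fun Q hQ _ => ?_, ?_⟩
    · obtain ⟨x, -⟩ := hne Q hQ
      exact hX.elim x
    · have h0 : #(cls c) = 0 := by
        rw [card_eq_zero]; exact eq_empty_of_isEmpty _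
      rw [h0] at hc
      refine hc.trans ?_
      simp
  choose! v hv using hne
  refine ⟨cls c \ (bad c).image v, sdiff_subset.trans (filter_subset _ _), fun Q hQ hsub => ?_, ?_⟩
  · have hQb : Q ∈ bad c := by
      refine mem_filter.mpr ⟨hQ, fun x hx => ?_⟩
      exact (mem_filter.mp (mem_sdiff.mp (hsub hx)).1).2
    exact (mem_sdiff.mp (hsub (hv Q hQ))).2 (mem_image_of_mem v hQb)
  · have h1 : #(cls c) ≤ #(cls c \ (bad c).image v) + #(bad c) :=
      (card_le_card_sdiff_add_card (s := cls c) (t := (bad c).image v)).trans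
        (Nat.add_le_add_left card_image_le _)
    have h2 : (#(cls c) : ℝ) ≤ #(cls c \ (bad c).image v) + #(bad c) := by exact_mod_cast h1
    linarith

/-! ### `k`-partite hypergraphs as families of functions, and their regular subfamilies. -/

/-- Two functions conflict if they agree in at least two places. -/
def Conflict {k m : ℕ} (g h : Fin k → Fin m) : Prop :=
  ∃ i j, i ≠ j ∧ g i = h i ∧ g j = h j

/-- Each coordinate value is taken either `0` or `r` times on `S`. -/
def IsCoordRegular {k m : ℕ} (r : ℕ) (S : Finset (Fin k → Fin m)) : Prop :=
  ∀ i y, #{g ∈ S | g i = y} = 0 ∨ #{g ∈ S | g i = y} = r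

/-- A family of functions `Fin k → Fin m` gives a `k`-partite `k`-graph on `k * m` vertices. -/
theorem card_le_maxRegularFree {k m n r : ℕ} (hr : 1 ≤ r) (hn : k * m ≤ n)
    (I : Finset (Fin k → Fin m))
    (hconf : ∀ g ∈ I, ∀ h ∈ I, g ≠ h → ¬ Conflict g h)
    (hreg : ∀ S ⊆ I, S.Nonempty → ¬ IsCoordRegular r S) :
    #I ≤ Hypergraph.maxRegularFree k r n := by
  classical
  set v : Fin k → Fin m → Fin n := fun i y => Fin.castLE hn (finProdFinEquiv (i, y)) with hv
  have hvinj : ∀ i y j z, v i y = v j z → i = j ∧ y = z := by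
    intro i y j z h
    have := finProdFinEquiv.injective (Fin.castLE_injective hn h)
    simpa using this
  set φ : (Fin k → Fin m) → Set (Fin n) := fun g => Set.range fun i => v i (g i) with hφ
  have hmem : ∀ g i y, v i y ∈ φ g ↔ g i = y := by
    intro g i y
    constructor
    · rintro ⟨j, hj⟩
      obtain ⟨rfl, h⟩ := hvinj _ _ _ _ hj
      exact h
    · rintro rfl; exact ⟨i, rfl⟩
  have hφinj : Function.Injective φ := by
    intro g h hgh
    funext i
    have : v i (g i) ∈ φ h := by rw [← hgh, hmem]
    exact ((hmem h i (g i)).mp this).symm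
  set H : Hypergraph (Fin n) :=
    { vertexSet := Set.univ
      edgeSet := φ '' (I : Set (Fin k → Fin m))
      subset_vertexSet_of_mem_edgeSet' := fun _ _ => Set.subset_univ _ } with hH
  refine (Hypergraph.isGreatest_maxRegularFree k r n hr).2 ⟨H, rfl, ?_, ?_, ?_, ?_⟩
  · rintro _ ⟨g, -, rfl⟩
    have : Function.Injective fun i => v i (g i) := fun i j h => (hvinj _ _ _ _ h).1
    rw [hφ]
    simp only
    rw [← Set.image_univ, this.encard_image, Set.encard_univ]
    simp
  · rintro _ ⟨g, hg, rfl⟩ _ ⟨h, hh, rfl⟩ hne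
    rw [Set.encard_le_one_iff]
    rintro _ _ ⟨⟨i, rfl⟩, hi⟩ ⟨⟨j, rfl⟩, hj⟩
    by_contra hij
    refine hconf g hg h hh (fun h => hne (by rw [h])) ⟨i, j, ?_, ?_, ?_⟩
    · rintro rfl; exact hij rfl
    · exact ((hmem _ _ _).mp hi).symm
    · exact ((hmem _ _ _).mp hj).symm
  · rintro ⟨K, ⟨-, hKE⟩, ⟨x, hx⟩, hdeg⟩
    set S : Finset (Fin k → Fin m) := {g ∈ I | φ g ∈ K.edgeSet} with hS
    have himg : ∀ u, {e | e ∈ K.edgeSet ∧ u ∈ e} =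
        φ '' (({g ∈ S | u ∈ φ g} : Finset (Fin k → Fin m)) : Set (Fin k → Fin m)) := by
      intro u
      ext e
      simp only [Set.mem_ofPred_eq, coe_filter, Set.mem_image, hS, mem_filter]
      constructor
      · rintro ⟨he, hu⟩
        obtain ⟨g, hg, rfl⟩ := hKE he
        exact ⟨g, ⟨⟨hg, he⟩, hu⟩, rfl⟩
      · rintro ⟨g, ⟨⟨-, he⟩, hu⟩, rfl⟩
        exact ⟨he, hu⟩
    have hdeg' : ∀ u ∈ K.vertexSet, #{g ∈ S | u ∈ φ g} = r := by
      intro u hu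
      have h := hdeg u hu
      rw [Hypergraph.degree, himg, hφinj.encard_image, Set.encard_coe_eq_coe_finsetCard] at h
      exact_mod_cast h
    refine hreg S (filter_subset _ _) ?_ ?_
    · have h := hdeg' x hx
      have : 0 < #{g ∈ S | x ∈ φ g} := by omega
      obtain ⟨g, hg⟩ := card_pos.mp this
      exact ⟨g, (mem_filter.mp hg).1⟩
    · intro i y
      by_cases hu : v i y ∈ K.vertexSet
      · right
        have h := hdeg' _ hu
        simpa only [hmem] using h
      · left
        rw [card_eq_zero, filter_eq_empty_iff]
        intro g hg hgi
        apply hu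
        exact K.subset_vertexSet_of_mem_edgeSet' (mem_filter.mp hg).2 ((hmem g i y).mpr hgi)
  · rw [hH]
    simp only
    rw [Set.ncard_image_of_injective _ hφinj, Set.ncard_coe_finset]

/-- The constant functions form a perfect matching, whose degrees are 1 and never `r`. This covers
the range in which the random construction is empty, and absorbs its additive loss elsewhere. -/
theorem le_maxRegularFree {k m n r : ℕ} (hr : 2 ≤ r) (hn : k * m ≤ n) (hk : 1 ≤ k) :
    m ≤ Hypergraph.maxRegularFree k r n := by
  classical
  have hinj : Function.Injective fun (y : Fin m) (_ : Fin k) => y := by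
    intro y z h
    exact congrFun h ⟨0, hk⟩
  have := card_le_maxRegularFree (r := r) (by omega) hn
    ((univ : Finset (Fin m)).image fun y => fun _ : Fin k => y) ?_ ?_
  · rwa [card_image_of_injective _ hinj, card_univ, Fintype.card_fin] at this
  · intro g hg h hh hne
    obtain ⟨y, -, rfl⟩ := mem_image.mp hg
    obtain ⟨z, -, rfl⟩ := mem_image.mp hh
    rintro ⟨i, -, -, h, -⟩
    exact hne (by rw [show y = z from h])
  · rintro S hS ⟨g, hg⟩ hreg
    obtain ⟨y, -, rfl⟩ := mem_image.mp (hS hg)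
    have h1 : #{g ∈ S | g ⟨0, hk⟩ = y} = 1 := by
      rw [card_eq_one]
      refine ⟨fun _ => y, ?_⟩
      ext h
      simp only [mem_filter, mem_singleton]
      constructor
      · rintro ⟨hh, h0⟩
        obtain ⟨z, -, rfl⟩ := mem_image.mp (hS hh)
        rw [show z = y from h0]
      · rintro rfl; exact ⟨hg, rfl⟩
    rcases hreg ⟨0, hk⟩ y with h | h <;> omega

/-- Each function conflicts with few others. -/
theorem card_conflict_le {k m : ℕ} (g : Fin k → Fin m) [DecidablePred (Conflict g)] :
    #{h | Conflict g h} ≤ k ^ 2 * m ^ (k - 2) := by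
  classical
  have hij : ∀ i j : Fin k, i ≠ j → #{h : Fin k → Fin m | g i = h i ∧ g j = h j} = m ^ (k - 2) := by
    intro i j hne
    have h1 : ({h : Fin k → Fin m | g i = h i ∧ g j = h j} : Finset (Fin k → Fin m)) =
        Fintype.piFinset fun x => if x ∈ ({i, j} : Finset (Fin k)) then {g x} else univ := by
      ext h
      simp only [mem_filter, mem_univ, true_and, Fintype.mem_piFinset]
      constructor
      · rintro ⟨hi, hj⟩ x
        split_ifs with hx
        · simp only [mem_insert, mem_singleton] at hx
          rcases hx with rfl | rfl
          · simp [hi]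
          · simp [hj]
        · simp
      · intro hx
        have hi := hx i
        have hj := hx j
        simp only [mem_insert, true_or, if_true, mem_singleton, or_true] at hi hj
        exact ⟨hi.symm, hj.symm⟩
    have h2 : ∀ x, #(if x ∈ ({i, j} : Finset (Fin k)) then ({g x} : Finset (Fin m)) else univ) =
        if x ∈ ({i, j} : Finset (Fin k)) then 1 else m := by
      intro x; split_ifs <;> simp
    rw [h1, Fintype.card_piFinset]
    simp only [h2]
    rw [prod_ite, prod_const_one, one_mul, prod_const, filter_notMem_eq_sdiff,
      card_sdiff_of_subset (subset_univ _), card_pair hne, card_univ, Fintype.card_fin]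
  calc #{h | Conflict g h}
      ≤ #((univ : Finset (Fin k × Fin k)).biUnion fun p => if p.1 ≠ p.2 then
          ({h : Fin k → Fin m | g p.1 = h p.1 ∧ g p.2 = h p.2} : Finset (Fin k → Fin m))
          else ∅) := by
        refine card_le_card fun h hh => ?_
        obtain ⟨i, j, hne, h1, h2⟩ := (mem_filter.mp hh).2
        rw [mem_biUnion]
        refine ⟨(i, j), mem_univ _, ?_⟩
        simp [hne, h1, h2]
    _ ≤ ∑ p : Fin k × Fin k, m ^ (k - 2) := by
        refine card_biUnion_le.trans (sum_le_sum fun p _ => ?_)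
        split_ifs with hp
        · exact (hij _ _ hp).le
        · simp
    _ = k ^ 2 * m ^ (k - 2) := by simp [sq]

/-- The allowed values of each coordinate: the coordinate `i₀` is restricted to `a` values. -/
def coordRange {k m : ℕ} (i₀ : Fin k) (a : ℕ) (i : Fin k) : Finset (Fin m) :=
  if i = i₀ then univ.filter fun x : Fin m => (x : ℕ) < a else univ

theorem prod_card_coordRange {k m a : ℕ} (i₀ : Fin k) (ham : a ≤ m) (f : ℕ → ℕ) :
    ∏ i, f #(coordRange (m := m) i₀ a i) = f a * f m ^ (k - 1) := by
  have h : ∀ i, f #(coordRange (m := m) i₀ a i) = if i = i₀ then f a else f m := by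
    intro i
    unfold coordRange
    split_ifs with h
    · congr 1
      rw [Fin.card_filter_val_lt]
      simpa using ham
    · simp
  simp only [h]
  rw [prod_ite, prod_const, prod_const]
  have h1 : ({x | x = i₀} : Finset (Fin k)) = {i₀} := by ext; simp
  have h2 : ({x | ¬ x = i₀} : Finset (Fin k)) = univ \ {i₀} := by ext; simp
  rw [h1, h2, card_singleton, pow_one, card_sdiff_of_subset (subset_univ _), card_singleton,
    card_univ, Fintype.card_fin]

/-- A coordinate-regular family takes the same number of values in each coordinate. -/
theorem IsCoordRegular.exists_box {k m r a : ℕ} (hr : 1 ≤ r) {i₀ : Fin k}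
    {S : Finset (Fin k → Fin m)} (hS : S ⊆ Fintype.piFinset (coordRange i₀ a)) (hne : S.Nonempty)
    (hreg : IsCoordRegular r S) :
    ∃ t ∈ Icc 1 a, ∃ P ∈ Fintype.piFinset fun i => (coordRange (m := m) i₀ a i).powersetCard t,
      S ∈ (Fintype.piFinset P).powersetCard (r * t) := by
  classical
  -- Every value taken is taken `r` times, so the number of values is the same in every coordinate.
  have hcard : ∀ i, #S = r * #(S.image fun g => g i) := by
    intro i
    rw [card_eq_sum_card_image (fun g : Fin k → Fin m => g i) S, mul_comm, ← smul_eq_mul,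
      ← sum_const]
    refine sum_congr rfl fun y hy => ?_
    obtain ⟨g, hg, rfl⟩ := mem_image.mp hy
    rcases hreg i (g i) with h | h
    · have : 0 < #{g' ∈ S | g' i = g i} := card_pos.mpr ⟨g, by simp [hg]⟩
      omega
    · exact h
  have hsub : ∀ i, (S.image fun g => g i) ⊆ coordRange i₀ a i := by
    intro i y hy
    obtain ⟨g, hg, rfl⟩ := mem_image.mp hy
    exact Fintype.mem_piFinset.mp (hS hg) i
  refine ⟨#(S.image fun g => g i₀), ?_, fun i => S.image fun g => g i, ?_, ?_⟩
  · rw [mem_Icc]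
    constructor
    · exact card_pos.mpr (hne.image _)
    · refine (card_le_card (hsub i₀)).trans ?_
      simp only [coordRange, if_true]
      rw [Fin.card_filter_val_lt]
      exact min_le_right _ _
  · rw [Fintype.mem_piFinset]
    intro i
    rw [mem_powersetCard]
    refine ⟨hsub i, ?_⟩
    have h1 := hcard i
    rw [hcard i₀] at h1
    exact (Nat.eq_of_mul_eq_mul_left hr h1).symm
  · rw [mem_powersetCard]
    refine ⟨fun g hg => ?_, hcard i₀⟩
    rw [Fintype.mem_piFinset]
    exact fun i => mem_image_of_mem _ hg

/-- The expected number of coordinate-regular families in a random family. -/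
theorem sum_regular_le {k m r a : ℕ} (hr : 1 ≤ r) (i₀ : Fin k) (ham : a ≤ m)
    {p : ℝ} (hp : 0 ≤ p) (𝒮 : Finset (Finset (Fin k → Fin m)))
    (h𝒮 : ∀ S ∈ 𝒮, S ⊆ Fintype.piFinset (coordRange i₀ a) ∧ S.Nonempty ∧ IsCoordRegular r S) :
    ∑ S ∈ 𝒮, p ^ #S ≤ ∑ t ∈ Icc 1 a, (a.choose t * m.choose t ^ (k - 1) *
      (t ^ k).choose (r * t) : ℕ) * p ^ (r * t) := by
  classical
  have hsub : 𝒮 ⊆ (Icc 1 a).biUnion fun t =>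
      (Fintype.piFinset fun i => (coordRange (m := m) i₀ a i).powersetCard t).biUnion fun P =>
        (Fintype.piFinset P).powersetCard (r * t) := by
    intro S hS
    obtain ⟨h1, h2, h3⟩ := h𝒮 S hS
    obtain ⟨t, ht, P, hP, hSP⟩ := h3.exists_box hr h1 h2
    exact mem_biUnion.mpr ⟨t, ht, mem_biUnion.mpr ⟨P, hP, hSP⟩⟩
  have hnn : ∀ S : Finset (Fin k → Fin m), 0 ≤ p ^ #S := fun S => by positivity
  refine (sum_le_sum_of_subset_of_nonneg hsub fun _ _ _ => hnn _).trans ?_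
  refine (sum_biUnion_le_sum_sum _ _ hnn).trans (sum_le_sum fun t _ => ?_)
  refine (sum_biUnion_le_sum_sum _ _ hnn).trans (le_of_eq ?_)
  have h1 : ∀ P ∈ Fintype.piFinset fun i => (coordRange (m := m) i₀ a i).powersetCard t,
      ∑ S ∈ (Fintype.piFinset P).powersetCard (r * t), p ^ #S =
        ((t ^ k).choose (r * t) : ℕ) * p ^ (r * t) := by
    intro P hP
    have h2 : #(Fintype.piFinset P) = t ^ k := by
      rw [Fintype.card_piFinset, prod_congr rfl (g := fun _ => t), prod_const, card_univ,
        Fintype.card_fin]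
      intro i _
      exact (mem_powersetCard.mp (Fintype.mem_piFinset.mp hP i)).2
    rw [sum_congr rfl (g := fun _ => p ^ (r * t))
      (fun S hS => by rw [(mem_powersetCard.mp hS).2]), sum_const, card_powersetCard, h2,
      nsmul_eq_mul]
  rw [sum_congr rfl h1, sum_const, Fintype.card_piFinset, nsmul_eq_mul]
  simp only [card_powersetCard]
  rw [prod_card_coordRange i₀ ham fun x => x.choose t]
  push_cast
  ring

/-- With `C(x, y) ≤ (3x / y) ^ y` the claim is the `t`-th power of one inequality. There `t`
survives with a nonnegative exponent, so the worst case is `t = a`, which is `hN`. The factor `4 ^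
t` makes the later sum geometric. -/
theorem regular_term_le {k r m a K t : ℕ} (hk : 2 ≤ k) (hr : 2 ≤ r)
    (hN : 4 * 3 ^ (k + r) * m ^ (k - 1) * a ^ ((k - 1) * (r - 1)) ≤ (r * K) ^ r)
    (ht1 : 1 ≤ t) (hta : t ≤ a) :
    4 ^ t * (a.choose t * m.choose t ^ (k - 1) * (t ^ k).choose (r * t)) ≤ K ^ (r * t) := by
  obtain ⟨p, rfl⟩ : ∃ p, k = p + 2 := ⟨k - 2, by omega⟩
  obtain ⟨s, rfl⟩ : ∃ s, r = s + 2 := ⟨r - 2, by omega⟩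
  simp only [show p + 2 - 1 = p + 1 by omega, show s + 2 - 1 = s + 1 by omega] at hN ⊢
  set k := p + 2 with hkd
  set r := s + 2 with hrd
  have hbase : 4 * (3 * a) * (3 * m) ^ (p + 1) * (3 * t ^ k) ^ r ≤ K ^ r * t ^ k * (r * t) ^ r := by
    -- The surplus exponent is `(k - 1) * (r - 1) - 1`; one more factor `a` comes from the choice in
    -- the small part.
    have hexp : k * r = (k + r) + (p * s + p + s) := by rw [hkd, hrd]; ring
    have hexp2 : (p + 1) * (s + 1) = 1 + (p * s + p + s) := by ring
    have hexp3 : (3 : ℕ) ^ (k + r) = 3 * 3 ^ (p + 1) * 3 ^ r := by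
      rw [hkd, pow_add 3 (p + 2) r]; ring
    calc 4 * (3 * a) * (3 * m) ^ (p + 1) * (3 * t ^ k) ^ r
        = 4 * 3 ^ (k + r) * m ^ (p + 1) * (a * t ^ (p * s + p + s)) * t ^ (k + r) := by
          rw [mul_pow, mul_pow, ← pow_mul, hexp, pow_add t (k + r), hexp3]; ring
      _ ≤ 4 * 3 ^ (k + r) * m ^ (p + 1) * (a * a ^ (p * s + p + s)) * t ^ (k + r) := by gcongr
      _ = 4 * 3 ^ (k + r) * m ^ (p + 1) * a ^ ((p + 1) * (s + 1)) * t ^ (k + r) := by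
          rw [hexp2, pow_add a 1, pow_one]
      _ ≤ (r * K) ^ r * t ^ (k + r) := by gcongr
      _ = _ := by rw [mul_pow, mul_pow, pow_add]; ring
  have h1 := choose_mul_pow_self_le a t
  have h2 := choose_mul_pow_self_le m t
  have h3 := choose_mul_pow_self_le (t ^ k) (r * t)
  have hpos : 0 < t ^ t * (t ^ t) ^ (p + 1) * (r * t) ^ (r * t) := by positivity
  refine Nat.le_of_mul_le_mul_right ?_ hpos
  calc 4 ^ t * (a.choose t * m.choose t ^ (p + 1) * (t ^ k).choose (r * t)) *
        (t ^ t * (t ^ t) ^ (p + 1) * (r * t) ^ (r * t))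
      = 4 ^ t * (a.choose t * t ^ t) * (m.choose t * t ^ t) ^ (p + 1) *
          ((t ^ k).choose (r * t) * (r * t) ^ (r * t)) := by rw [mul_pow]; ring
    _ ≤ 4 ^ t * (3 * a) ^ t * ((3 * m) ^ t) ^ (p + 1) * (3 * t ^ k) ^ (r * t) := by gcongr
    _ = (4 * (3 * a) * (3 * m) ^ (p + 1) * (3 * t ^ k) ^ r) ^ t := by
        generalize 3 * a = u, 3 * m = v, 3 * t ^ k = z
        rw [mul_pow, mul_pow, mul_pow, ← pow_mul v, ← pow_mul v, ← pow_mul z, mul_comm t]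
    _ ≤ (K ^ r * t ^ k * (r * t) ^ r) ^ t := by gcongr
    _ = _ := by
        rw [mul_pow _ _ t, mul_pow _ _ t, ← pow_mul, ← pow_mul, ← pow_mul, ← pow_mul, hkd]
        ring

theorem sum_quarter_pow_le (a : ℕ) : ∑ t ∈ Icc 1 a, (1 / 4 : ℝ) ^ t ≤ 1 / 3 := by
  have h : ∑ t ∈ Icc 1 a, (1 / 4 : ℝ) ^ t = 1 / 3 - 1 / 3 * (1 / 4) ^ a := by
    induction a with
    | zero => simp
    | succ a ih => rw [sum_Icc_succ_top (by omega), ih]; ring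
  rw [h]
  have : (0 : ℝ) < (1 / 4) ^ a := by positivity
  linarith

/-- The random `k`-partite construction. -/
theorem le_maxRegularFree_of_sparse {k r n m a : ℕ} (hk : 2 ≤ k) (hr : 2 ≤ r) (hm : 1 ≤ m)
    (hn : k * m ≤ n) (ham : a ≤ m)
    (hN : 4 * 3 ^ (k + r) * m ^ (k - 1) * a ^ ((k - 1) * (r - 1)) ≤
      (r * (4 * k ^ 2 * m ^ (k - 2))) ^ r) :
    3 / 4 * ((a : ℝ) * m / (4 * k ^ 2)) - 1 / 3 ≤ Hypergraph.maxRegularFree k r n := by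
  classical
  -- A function has at most `K / 4` conflicts, so at density `1 / K` conflicting pairs cost at most
  -- a quarter of the expected size.
  set K := 4 * k ^ 2 * m ^ (k - 2) with hK
  set i₀ : Fin k := ⟨0, by omega⟩
  set E : Finset (Fin k → Fin m) := Fintype.piFinset (coordRange i₀ a) with hE
  have hEc : #E = a * m ^ (k - 1) := by
    rw [hE, Fintype.card_piFinset]
    exact prod_card_coordRange i₀ ham fun x => x
  set pairs := E.sigma fun g => ({h | Conflict g h ∧ g ≠ h} : Finset (Fin k → Fin m)) with hpairs
  set 𝒬₁ := pairs.image fun p => ({p.1, p.2} : Finset (Fin k → Fin m)) with h𝒬₁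
  set 𝒬₂ : Finset (Finset (Fin k → Fin m)) := {S ∈ E.powerset | S.Nonempty ∧ IsCoordRegular r S}
    with h𝒬₂
  have hK1 : 1 ≤ K := by
    have : 0 < K := by positivity
    exact this
  have hK0 : (0 : ℝ) < K := by exact_mod_cast hK1
  obtain ⟨I, hIE, hI, hIc⟩ := exists_independent E (𝒬₁ ∪ 𝒬₂) (by
    intro Q hQ
    rcases mem_union.mp hQ with h | h
    · obtain ⟨p, -, rfl⟩ := mem_image.mp h
      exact ⟨p.1, by simp⟩
    · exact (mem_filter.mp h).2.1) hK1
  have hIf : #I ≤ Hypergraph.maxRegularFree k r n := by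
    refine card_le_maxRegularFree (by omega) hn I ?_ ?_
    · intro g hg h hh hne hc
      refine hI {g, h} (mem_union_left _ (mem_image.mpr ⟨⟨g, h⟩, ?_, rfl⟩)) ?_
      · rw [hpairs, mem_sigma]
        exact ⟨hIE hg, mem_filter.mpr ⟨mem_univ _, hc, hne⟩⟩
      · exact insert_subset hg (singleton_subset_iff.mpr hh)
    · intro S hS hne hreg
      exact hI S (mem_union_right _ (mem_filter.mpr
        ⟨mem_powerset.mpr (hS.trans hIE), hne, hreg⟩)) hS
  have hs1 : ∑ Q ∈ 𝒬₁, (1 / (K : ℝ)) ^ #Q ≤ #E / K * (1 / 4) := by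
    have h1 : ∀ Q ∈ 𝒬₁, (1 / (K : ℝ)) ^ #Q = (1 / (K : ℝ)) ^ 2 := by
      intro Q hQ
      obtain ⟨p, hp, rfl⟩ := mem_image.mp hQ
      rw [hpairs, mem_sigma] at hp
      rw [card_pair (mem_filter.mp hp.2).2.2]
    have h2 : #𝒬₁ ≤ #E * (k ^ 2 * m ^ (k - 2)) := by
      refine card_image_le.trans ?_
      rw [hpairs, card_sigma, ← smul_eq_mul, ← sum_const]
      refine sum_le_sum fun g _ => ?_
      refine le_trans (card_le_card ?_) (card_conflict_le g)
      intro h hh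
      exact mem_filter.mpr ⟨mem_univ _, (mem_filter.mp hh).2.1⟩
    have h3 : (#𝒬₁ : ℝ) ≤ #E * (K / 4) := by
      have h : (#𝒬₁ : ℝ) ≤ #E * ((k : ℝ) ^ 2 * (m : ℝ) ^ (k - 2)) := by exact_mod_cast h2
      refine h.trans (le_of_eq ?_)
      rw [hK]; push_cast; ring
    rw [sum_congr rfl h1, sum_const, nsmul_eq_mul]
    calc (#𝒬₁ : ℝ) * (1 / (K : ℝ)) ^ 2 ≤ #E * (K / 4) * (1 / (K : ℝ)) ^ 2 := by gcongr
      _ = _ := by field_simp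
  have hs2 : ∑ Q ∈ 𝒬₂, (1 / (K : ℝ)) ^ #Q ≤ 1 / 3 := by
    refine (sum_regular_le (r := r) (a := a) (by omega) i₀ ham (by positivity) 𝒬₂ ?_).trans ?_
    · intro S hS
      obtain ⟨h1, h2, h3⟩ := mem_filter.mp hS
      exact ⟨mem_powerset.mp h1, h2, h3⟩
    · refine le_trans (sum_le_sum fun t ht => ?_) (sum_quarter_pow_le a)
      rw [mem_Icc] at ht
      have h := regular_term_le hk hr hN ht.1 ht.2
      have h' : (4 : ℝ) ^ t * ((a.choose t * m.choose t ^ (k - 1) *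
          (t ^ k).choose (r * t) : ℕ) : ℝ) ≤ (K : ℝ) ^ (r * t) := by exact_mod_cast h
      have hKp : (0 : ℝ) < (K : ℝ) ^ (r * t) := by positivity
      rw [one_div_pow, one_div_pow, mul_one_div, div_le_div_iff₀ hKp (by positivity)]
      linarith
  have hs : ∑ Q ∈ 𝒬₁ ∪ 𝒬₂, (1 / (K : ℝ)) ^ #Q ≤ #E / K * (1 / 4) + 1 / 3 := by
    have h1 := sum_union_inter (s₁ := 𝒬₁) (s₂ := 𝒬₂) (f := fun Q => (1 / (K : ℝ)) ^ #Q)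
    have h2 : 0 ≤ ∑ Q ∈ 𝒬₁ ∩ 𝒬₂, (1 / (K : ℝ)) ^ #Q := sum_nonneg fun Q _ => by positivity
    linarith
  have hEK : (#E : ℝ) / K = (a : ℝ) * m / (4 * k ^ 2) := by
    have hm0 : (0 : ℝ) < m := by exact_mod_cast hm
    have hk0 : (0 : ℝ) < k := by
      have : 0 < k := by omega
      exact_mod_cast this
    rw [hEc, hK]
    push_cast
    rw [show k - 1 = k - 2 + 1 by omega, pow_succ]
    field_simp
  have hIf' : (#I : ℝ) ≤ Hypergraph.maxRegularFree k r n := by exact_mod_cast hIf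
  rw [hEK] at hIc hs
  linarith

/-! ### Choice of parameters and the lower bound. -/

/-- The constant in the size of the small part of the construction. -/
theorem exists_part_constant (k : ℕ) (hk : 2 ≤ k) :
    ∃ c : ℝ, 0 < c ∧ c * (2 * k) ≤ 1 ∧ ∀ r : ℕ, 2 ≤ r →
      4 * 3 ^ (k + r) * ((2 * (k : ℝ)) ^ (k - 2)) ^ r * c ^ ((k - 1) * (r - 1)) ≤ 1 := by
  set B : ℝ := 3 ^ (k + 1) * (2 * (k : ℝ)) ^ (k - 2) with hB
  have hk2 : (2 : ℝ) ≤ k := by exact_mod_cast hk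
  have hp1 : (1 : ℝ) ≤ (2 * (k : ℝ)) ^ (k - 2) := one_le_pow₀ (by linarith)
  have h3k : (k : ℝ) ≤ 3 ^ (k + 1) := by
    have h1 : k < 3 ^ k := Nat.lt_pow_self (by norm_num)
    have h2 : (k : ℝ) < 3 ^ k := by exact_mod_cast h1
    rw [pow_succ]; linarith [pow_pos (show (0 : ℝ) < 3 by norm_num) k]
  have hBk : (k : ℝ) ≤ B := h3k.trans (le_mul_of_one_le_right (by positivity) hp1)
  have hB1 : 1 ≤ B := by linarith
  -- For `r ≥ 2`, `B ^ r ≤ (B ^ 2) ^ (r - 1)`, while the 4 in the denominator beats the leading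
  -- factor 4.
  refine ⟨1 / (4 * B ^ 2), by positivity, ?_, ?_⟩
  · rw [div_mul_eq_mul_div, one_mul, div_le_one (by positivity)]
    nlinarith
  · intro r hr
    obtain ⟨s, rfl⟩ : ∃ s, r = s + 2 := ⟨r - 2, by omega⟩
    have hc1 : 1 / (4 * B ^ 2) ≤ 1 := by
      rw [div_le_one (by positivity)]; nlinarith
    have h1 : (1 / (4 * B ^ 2)) ^ ((k - 1) * (s + 2 - 1)) ≤ (1 / (4 * B ^ 2)) ^ (s + 1) := by
      refine pow_le_pow_of_le_one (by positivity) hc1 ?_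
      rw [show s + 2 - 1 = s + 1 by omega]
      exact Nat.le_mul_of_pos_left _ (by omega)
    have h2 : (3 : ℝ) ^ (k + (s + 2)) * ((2 * (k : ℝ)) ^ (k - 2)) ^ (s + 2) ≤ B ^ (s + 2) := by
      rw [hB, mul_pow (3 ^ (k + 1))]
      gcongr
      rw [← pow_mul]
      refine pow_le_pow_right₀ (by norm_num) ?_
      nlinarith
    have h3 : B ^ (s + 2) ≤ (B ^ 2) ^ (s + 1) := by
      rw [← pow_mul]
      exact pow_le_pow_right₀ hB1 (by omega)
    calc 4 * 3 ^ (k + (s + 2)) * ((2 * (k : ℝ)) ^ (k - 2)) ^ (s + 2) *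
          (1 / (4 * B ^ 2)) ^ ((k - 1) * (s + 2 - 1))
        = 4 * (3 ^ (k + (s + 2)) * ((2 * (k : ℝ)) ^ (k - 2)) ^ (s + 2)) *
          (1 / (4 * B ^ 2)) ^ ((k - 1) * (s + 2 - 1)) := by ring
      _ ≤ 4 * (B ^ 2) ^ (s + 1) * (1 / (4 * B ^ 2)) ^ (s + 1) := by
          gcongr
          exact h2.trans h3
      _ = 4 * (1 / 4) ^ (s + 1) := by
          rw [mul_assoc, ← mul_pow]
          congr 2
          field_simp
      _ ≤ 1 := by
          rw [pow_succ]
          have : ((1 : ℝ) / 4) ^ s ≤ 1 := pow_le_one₀ (by norm_num) (by norm_num)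
          linarith

theorem exists_lower_bound (k : ℕ) (hk : 2 ≤ k) :
    ∃ C₀ : ℝ, 0 < C₀ ∧ ∀ r n : ℕ, 2 ≤ r → r ≤ n → k ≤ n →
      C₀ * (r : ℝ) ^ (1 / ((k : ℝ) - 1)) *
          (n : ℝ) ^ (2 - (r : ℝ) / (((r : ℝ) - 1) * ((k : ℝ) - 1))) ≤
        (Hypergraph.maxRegularFree k r n : ℝ) := by
  obtain ⟨c, hc0, hck, hc⟩ := exists_part_constant k hk
  have hk2 : (2 : ℝ) ≤ k := by exact_mod_cast hk
  have hk0 : (0 : ℝ) < k := by linarith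
  refine ⟨c / (64 * k ^ 3), by positivity, fun r n hr hrn hkn => ?_⟩
  have hr2 : (2 : ℝ) ≤ r := by exact_mod_cast hr
  have hrn' : (r : ℝ) ≤ n := by exact_mod_cast hrn
  have hn0 : (0 : ℝ) < n := by linarith
  have hk1 : (0 : ℝ) < (k : ℝ) - 1 := by linarith
  have hr1 : (0 : ℝ) < (r : ℝ) - 1 := by linarith
  have hcastk : ((k - 1 : ℕ) : ℝ) = (k : ℝ) - 1 := by
    rw [Nat.cast_sub (by omega)]; simp
  have hcastr : ((r - 1 : ℕ) : ℝ) = (r : ℝ) - 1 := by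
    rw [Nat.cast_sub (by omega)]; simp
  -- The intended size of the small part, obtained by solving `hN` for `a` up to constants.
  set x : ℝ := c * ((r : ℝ) ^ (1 / ((k : ℝ) - 1)) *
    (n : ℝ) ^ (1 - (r : ℝ) / (((r : ℝ) - 1) * ((k : ℝ) - 1)))) with hx
  have hx0 : 0 ≤ x := by positivity
  have htarget : c / (64 * k ^ 3) * (r : ℝ) ^ (1 / ((k : ℝ) - 1)) *
      (n : ℝ) ^ (2 - (r : ℝ) / (((r : ℝ) - 1) * ((k : ℝ) - 1))) = x * n / (64 * k ^ 3) := by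
    rw [hx, show 2 - (r : ℝ) / (((r : ℝ) - 1) * ((k : ℝ) - 1)) =
      1 - (r : ℝ) / (((r : ℝ) - 1) * ((k : ℝ) - 1)) + 1 by ring, Real.rpow_add_one hn0.ne']
    ring
  rw [htarget]
  -- The hypothesis `r ≤ n` enters here, so that the small part fits into a part of size `m`.
  have hxn : x ≤ c * n := by
    rw [hx]
    gcongr
    calc (r : ℝ) ^ (1 / ((k : ℝ) - 1)) *
          (n : ℝ) ^ (1 - (r : ℝ) / (((r : ℝ) - 1) * ((k : ℝ) - 1)))
        ≤ (n : ℝ) ^ (1 / ((k : ℝ) - 1)) *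
          (n : ℝ) ^ (1 - (r : ℝ) / (((r : ℝ) - 1) * ((k : ℝ) - 1))) := by gcongr
      _ = (n : ℝ) ^ (1 - 1 / (((r : ℝ) - 1) * ((k : ℝ) - 1))) := by
          rw [← Real.rpow_add hn0]
          congr 1
          field_simp
          ring
      _ ≤ (n : ℝ) ^ (1 : ℝ) := by
          refine Real.rpow_le_rpow_of_exponent_le (by linarith) ?_
          have : 0 < 1 / (((r : ℝ) - 1) * ((k : ℝ) - 1)) := by positivity
          linarith
      _ = n := Real.rpow_one _
  have hxpow : x ^ ((k - 1) * (r - 1)) * (n : ℝ) ^ r =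
      c ^ ((k - 1) * (r - 1)) * (r : ℝ) ^ (r - 1) * (n : ℝ) ^ ((k - 1) * (r - 1)) := by
    rw [hx, mul_pow, mul_pow]
    have h1 : ((r : ℝ) ^ (1 / ((k : ℝ) - 1))) ^ ((k - 1) * (r - 1)) = (r : ℝ) ^ (r - 1) := by
      rw [pow_mul, ← Real.rpow_natCast _ (k - 1), hcastk, ← Real.rpow_mul (by positivity),
        one_div_mul_cancel hk1.ne', Real.rpow_one]
    have h2 : ((n : ℝ) ^ (1 - (r : ℝ) / (((r : ℝ) - 1) * ((k : ℝ) - 1)))) ^ ((k - 1) * (r - 1)) *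
        (n : ℝ) ^ r = (n : ℝ) ^ ((k - 1) * (r - 1)) := by
      rw [← Real.rpow_natCast _ ((k - 1) * (r - 1)), ← Real.rpow_mul (by positivity),
        ← Real.rpow_natCast _ r, ← Real.rpow_add hn0, ← Real.rpow_natCast _ ((k - 1) * (r - 1))]
      congr 1
      push_cast
      rw [hcastk, hcastr]
      field_simp
      ring
    rw [h1, mul_assoc, mul_assoc, h2, mul_assoc]
  set m := n / k with hm
  have hkm : k * m ≤ n := Nat.mul_div_le n k
  have hm1 : 1 ≤ m := Nat.div_pos hkn (by omega)
  have hn2 : n ≤ 2 * k * m := by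
    have h1 := Nat.lt_div_mul_add (a := n) (b := k) (by omega)
    rw [← hm] at h1
    nlinarith [Nat.mul_le_mul_right k hm1]
  have hn2' : (n : ℝ) ≤ 2 * k * m := by exact_mod_cast hn2
  have hm1' : (1 : ℝ) ≤ m := by exact_mod_cast hm1
  have hmn' : (m : ℝ) ≤ n := by exact_mod_cast Nat.div_le_self n k
  have hfm : (m : ℝ) ≤ Hypergraph.maxRegularFree k r n := by
    exact_mod_cast le_maxRegularFree hr hkm (by omega)
  set a := ⌊x⌋₊ with ha
  have hax : (a : ℝ) ≤ x := Nat.floor_le hx0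
  have ham : a ≤ m := by
    have h : (a : ℝ) ≤ m := by
      calc (a : ℝ) ≤ c * n := hax.trans hxn
        _ ≤ c * (2 * k * m) := by gcongr
        _ = c * (2 * k) * m := by ring
        _ ≤ 1 * m := by gcongr
        _ = m := one_mul _
    exact_mod_cast h
  have hN : 4 * 3 ^ (k + r) * m ^ (k - 1) * a ^ ((k - 1) * (r - 1)) ≤
      (r * (4 * k ^ 2 * m ^ (k - 2))) ^ r := by
    have hR : 4 * 3 ^ (k + r) * (m : ℝ) ^ (k - 1) * (a : ℝ) ^ ((k - 1) * (r - 1)) ≤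
        ((r : ℝ) * (4 * (k : ℝ) ^ 2 * (m : ℝ) ^ (k - 2))) ^ r := by
      have hnr : (0 : ℝ) < (n : ℝ) ^ r := by positivity
      refine le_of_mul_le_mul_right ?_ hnr
      have hexp : (k - 1) + (k - 1) * (r - 1) = (k - 2) * r + r := by
        obtain ⟨p, rfl⟩ : ∃ p, k = p + 2 := ⟨k - 2, by omega⟩
        obtain ⟨s, rfl⟩ : ∃ s, r = s + 2 := ⟨r - 2, by omega⟩
        simp only [show p + 2 - 1 = p + 1 by omega, show s + 2 - 1 = s + 1 by omega,
          Nat.add_sub_cancel]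
        ring
      calc 4 * 3 ^ (k + r) * (m : ℝ) ^ (k - 1) * (a : ℝ) ^ ((k - 1) * (r - 1)) * (n : ℝ) ^ r
          ≤ 4 * 3 ^ (k + r) * (n : ℝ) ^ (k - 1) * x ^ ((k - 1) * (r - 1)) * (n : ℝ) ^ r := by
            gcongr
        _ = 4 * 3 ^ (k + r) * c ^ ((k - 1) * (r - 1)) * (r : ℝ) ^ (r - 1) *
            ((n : ℝ) ^ (k - 1) * (n : ℝ) ^ ((k - 1) * (r - 1))) := by
            rw [mul_assoc _ (x ^ _), hxpow]; ring
        _ = 4 * 3 ^ (k + r) * c ^ ((k - 1) * (r - 1)) * (r : ℝ) ^ (r - 1) *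
            (((n : ℝ) ^ (k - 2)) ^ r * (n : ℝ) ^ r) := by
            rw [← pow_add (n : ℝ) (k - 1), hexp, pow_add (n : ℝ) ((k - 2) * r), pow_mul (n : ℝ)]
        _ ≤ 4 * 3 ^ (k + r) * c ^ ((k - 1) * (r - 1)) * (r : ℝ) ^ r *
            (((2 * k * m : ℝ) ^ (k - 2)) ^ r * (n : ℝ) ^ r) := by
            gcongr
            · linarith
            · omega
        _ = (4 * 3 ^ (k + r) * ((2 * (k : ℝ)) ^ (k - 2)) ^ r * c ^ ((k - 1) * (r - 1))) *
            ((r : ℝ) * (m : ℝ) ^ (k - 2)) ^ r * (n : ℝ) ^ r := by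
            rw [mul_pow (2 * (k : ℝ)) m, mul_pow _ _ r, mul_pow _ _ r]; ring
        _ ≤ 1 * ((r : ℝ) * (4 * (k : ℝ) ^ 2 * (m : ℝ) ^ (k - 2))) ^ r * (n : ℝ) ^ r := by
            gcongr
            · exact hc r hr
            · exact le_mul_of_one_le_left (by positivity) (by nlinarith)
        _ = _ := by rw [one_mul]
    exact_mod_cast hR
  have hfa := le_maxRegularFree_of_sparse hk hr hm1 hkm ham hN
  set f : ℝ := (Hypergraph.maxRegularFree k r n : ℝ)
  have hk3 : (k : ℝ) ≤ k ^ 3 := le_self_pow₀ (by linarith) (by norm_num)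
  -- For `x < 1` the small part is empty and the matching of size `m` is enough.
  rcases lt_or_ge x 1 with hx1 | hx1
  · rw [div_le_iff₀ (by positivity)]
    calc x * n ≤ 1 * (2 * k * m) := by gcongr
      _ = m * (2 * k) := by ring
      _ ≤ f * (64 * k ^ 3) := by
          gcongr
          · norm_num
  · have ha2 : x / 2 ≤ a := by
      have h1 : x < a + 1 := Nat.lt_floor_add_one x
      have h2 : 1 ≤ a := Nat.le_floor (by simpa using hx1)
      have h3 : (1 : ℝ) ≤ a := by exact_mod_cast h2
      linarith
    have h1 : x * n ≤ 4 * k * (a * m) := by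
      calc x * n ≤ (2 * a) * (2 * k * m) := by gcongr; linarith
        _ = _ := by ring
    have h2 : x * n / (64 * k ^ 3) ≤ (a * m / (4 * k ^ 2)) / 4 := by
      rw [div_div, div_le_div_iff₀ (by positivity) (by positivity)]
      calc x * n * (4 * k ^ 2 * 4) ≤ 4 * k * (a * m) * (4 * k ^ 2 * 4) := by gcongr
        _ = _ := by ring
    have h3 : 0 ≤ (a : ℝ) * m / (4 * k ^ 2) := by positivity
    -- The loss of `1 / 3` is absorbed because `f ≥ m ≥ 1`.
    linarith

end

theorem theorem1p3 (k : ℕ) (hk : 2 ≤ k) :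
    ∃ C₀ C₁ C₂ : ℝ, 0 < C₀ ∧ 0 < C₁ ∧ 0 < C₂ ∧
      ∀ r n : ℕ, 2 ≤ r → r ≤ n →
        (k ≤ n →
          C₀ * (r : ℝ) ^ (1 / ((k : ℝ) - 1)) *
              (n : ℝ) ^ (2 - (r : ℝ) / (((r : ℝ) - 1) * ((k : ℝ) - 1))) ≤
            (Hypergraph.maxRegularFree k r n : ℝ)) ∧
        (Hypergraph.maxRegularFree k r n : ℝ) ≤
          C₁ * (r : ℝ) ^ (1 / ((k : ℝ) - 1)) *
            (n : ℝ) ^ (2 - 1 / ((k : ℝ) - 1)) * Real.log (n : ℝ) ^ C₂ := by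
  obtain ⟨C₀, hC₀, hlow⟩ := exists_lower_bound k hk
  obtain ⟨C₁, C₂, hC₁, hC₂, hupp⟩ := exists_upper_bound k hk
  exact ⟨C₀, C₁, C₂, hC₀, hC₁, hC₂, fun r n hr hrn =>
    ⟨fun hkn => hlow r n hr hrn hkn, hupp r n (by omega) (by omega)⟩⟩
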